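/- All graphs are finite and simple. The cycle spectrum $\mathcal{C}(G)$ of a graph $G$ is the set of lengths of its cycles, and its circumference is the length of a longest cycle. A graph is cubic if all its vertices have degree $3$. For $m\ge 1$ let $H_m$ be the graph consisting of two disjoint cycles $x_0x_1\ldots x_{2m}x_0$ and $y_0y_1\ldots y_{2m}y_0$ together with the chords $x_ix_{2m-i}$ and $y_iy_{2m-i}$ for $1\le i\le m-1$ and the edge $x_my_m$. If $D$ is a cubic graph and $e=ab$ is an edge of $D$, where $a$ has the further neighbours $a_1,a_2$ and $b$ has the further neighbours $b_1,b_2$, then replacing $e$ by $H_m$ means deleting $a$ and $b$, adding a disjoint copy of $H_m$, and adding the edges $a_1x_0$, $a_2x_{2m}$, $b_1y_0$, $b_2y_{2m}$. For $n\ge 3$ let $D_n$ be the cubic graph consisting of three disjoint cycles $u_1\ldots u_nu_1$, $v_1\ldots v_nv_1$ and $w_1\ldots w_{2n}w_1$ together with the edges $v_iw_{2i-1}$ and $u_iw_{2i}$ for $1\le i\le n$; the latter edges form a perfect matching $M$ of $D_n$. For $k\ge 2$ let $G(n,k)$ be the graph obtained from $D_n$ by replacing every edge of $M$ by $H_{k-1}$.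 **Theorem.** Let $k\ge 2$ be an integer. Then there exists a $3$-connected cubic planar graph $G$ of circumference at least $2k$ such that $\mathcal{C}(G)\cap[2k,4k+1]=\emptyset$. More precisely, for every integer $n\ge 4k+2$ the graph $G(n,k)$ is a $3$-connected cubic planar graph of circumference at least $2k$ with $\mathcal{C}(G(n,k))\cap[2k,4k+1]=\emptyset$, and the graphs $G(n,k)$, $n\ge 4k+2$, are pairwise non-isomorphic, so that there are infinitely many such graphs. -/

import Mathlib

/-!
Cycle spectra of finite simple graphs, planarity through drawings in the plane, and the graphs
`G(n, k)` obtained from the ring graph `D_n` by replacing the edges of a perfect matching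
with copies of the gadget `H_{k-1}`.
-/

namespace CycleGap

/-- The cycle spectrum of `G`: the set of lengths of cycles in `G`. -/
def cycleSpectrum {V : Type*} (G : SimpleGraph V) : Set ℕ :=
  {l | ∃ (v : V) (c : G.Walk v v), c.IsCycle ∧ c.length = l}

/-- The circumference of `G`: the length of a longest cycle (`0` if `G` has no cycle). -/
noncomputable def circumference {V : Type*} (G : SimpleGraph V) : ℕ :=
  sSup (cycleSpectrum G)

/-- A finite graph is 3-connected if it has more than three vertices and remains connected
after the deletion of any set of fewer than three vertices. -/
def IsThreeConnected {V : Type*} [Fintype V] (G : SimpleGraph V) : Prop :=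
  3 < Fintype.card V ∧
    ∀ S : Finset V, S.card < 3 → (G.induce {v | v ∉ S}).Connected

open Classical in
/-- A finite graph is cubic if every vertex has degree three. -/
def IsCubic {V : Type*} [Fintype V] (G : SimpleGraph V) : Prop :=
  G.IsRegularOfDegree 3

/-- A drawing of `G` in the plane without crossings: the vertices are distinct points, every edge
`uv` is a simple arc from `u` to `v` that contains no other vertex, and the arcs of two distinct
edges meet in common end vertices only. -/
structure PlaneDrawing {V : Type*} (G : SimpleGraph V) where
  pos : V → ℝ × ℝ
  pos_injective : Function.Injective pos
  arc : Sym2 V → Set (ℝ × ℝ)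
  arc_eq_range : ∀ u v : V, G.Adj u v →
    ∃ γ : Path (pos u) (pos v), Function.Injective γ ∧ Set.range γ = arc s(u, v)
  mem_of_pos_mem_arc : ∀ e ∈ G.edgeSet, ∀ w : V, pos w ∈ arc e → w ∈ e
  arc_inter_arc : ∀ e ∈ G.edgeSet, ∀ f ∈ G.edgeSet, e ≠ f →
    ∀ p ∈ arc e ∩ arc f, ∃ w : V, w ∈ e ∧ w ∈ f ∧ p = pos w

/-- A graph is planar if it has a drawing in the plane without crossings. -/
def IsPlanar {V : Type*} (G : SimpleGraph V) : Prop :=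
  Nonempty (PlaneDrawing G)

/-- The cycle `x_0 x_1 … x_{2m} x_0` together with the chords `x_i x_{2m-i}`, `1 ≤ i ≤ m - 1`. -/
def chordedCycle (m : ℕ) : SimpleGraph (Fin (2 * m + 1)) :=
  SimpleGraph.cycleGraph (2 * m + 1) ⊔
    SimpleGraph.fromRel fun i j => 1 ≤ i.val ∧ i.val < m ∧ i.val + j.val = 2 * m

/-- The middle vertex `x_m` of `x_0 … x_{2m}`. -/
def mid (m : ℕ) : Fin (2 * m + 1) := ⟨m, by omega⟩

/-- The gadget `H_m`: two disjoint copies of the chorded cycle on `x_0, …, x_{2m}` and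
`y_0, …, y_{2m}` and the edge `x_m y_m`. Here `x_i` is `(false, i)` and `y_i` is `(true, i)`. -/
def gadget (m : ℕ) : SimpleGraph (Bool × Fin (2 * m + 1)) where
  Adj p q := (p.1 = q.1 ∧ (chordedCycle m).Adj p.2 q.2) ∨
    (p.1 ≠ q.1 ∧ p.2 = mid m ∧ q.2 = mid m)
  symm := ⟨by
    rintro p q (⟨h, h'⟩ | ⟨h, h₁, h₂⟩)
    · exact Or.inl ⟨h.symm, h'.symm⟩
    · exact Or.inr ⟨h.symm, h₂, h₁⟩⟩
  loopless := ⟨by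
    rintro p (⟨_, h⟩ | ⟨h, _⟩)
    · exact (chordedCycle m).irrefl h
    · exact h rfl⟩

/-- The graph `D(M, H_m)` obtained from a cubic graph `D` by replacing every edge of a perfect
matching `M` of `D` with a copy of `H_m`.

For every edge `ab` of `M` there is a copy of `H_m` on the vertices `(a, i)` and `(b, i)`, which
play the roles of `x_i` and `y_i`. An edge `ab` of `D` outside `M` becomes the edge that joins
`(a, port a b)` and `(b, port b a)`; so `port a` has to assign the indices `0` and `2m` to the
two neighbours of `a` along edges outside `M`. (The two ways of doing this give isomorphic graphs,
as `x_i ↦ x_{2m-i}` extends to an automorphism of `H_m` that fixes every `y_i`.) -/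
def replaceMatching {V : Type*} (D M : SimpleGraph V) (m : ℕ) (port : V → V → Fin (2 * m + 1)) :
    SimpleGraph (V × Fin (2 * m + 1)) where
  Adj p q :=
    (∃ e : Bool → V, M.Adj (e false) (e true) ∧
      ∃ s t, (gadget m).Adj s t ∧ p = (e s.1, s.2) ∧ q = (e t.1, t.2)) ∨
    (D.Adj p.1 q.1 ∧ ¬ M.Adj p.1 q.1 ∧ p.2 = port p.1 q.1 ∧ q.2 = port q.1 p.1)
  symm := ⟨by
    rintro p q (⟨e, he, s, t, hst, hp, hq⟩ | ⟨h₁, h₂, h₃, h₄⟩)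
    · exact Or.inl ⟨e, he, t, s, hst.symm, hq, hp⟩
    · exact Or.inr ⟨h₁.symm, fun h => h₂ h.symm, h₄, h₃⟩⟩
  loopless := ⟨by
    rintro p (⟨e, he, ⟨s, i⟩, ⟨t, j⟩, hst, hp, hq⟩ | ⟨h, _⟩)
    · rw [hp, Prod.mk.injEq] at hq
      obtain ⟨h₁, h₂⟩ := hq
      simp only at h₁ h₂
      subst h₂
      cases s <;> cases t
      · exact (gadget m).irrefl hst
      · exact M.ne_of_adj he h₁
      · exact M.ne_of_adj he h₁.symm
      · exact (gadget m).irrefl hst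
    · exact D.irrefl h⟩

/-- The vertices `u_i`, `v_i` (`i < n`) and `w_j` (`j < 2n`) of `D_n`, numbered from `0`. -/
abbrev RingVertex (n : ℕ) : Type := (Fin n ⊕ Fin n) ⊕ Fin (2 * n)

/-- The vertex `u_i`. -/
def u {n : ℕ} (i : Fin n) : RingVertex n := Sum.inl (Sum.inl i)

/-- The vertex `v_i`. -/
def v {n : ℕ} (i : Fin n) : RingVertex n := Sum.inl (Sum.inr i)

/-- The vertex `w_j`. -/
def w {n : ℕ} (j : Fin (2 * n)) : RingVertex n := Sum.inr j

/-- The disjoint cycles `u_0 … u_{n-1}`, `v_0 … v_{n-1}` and `w_0 … w_{2n-1}`. -/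
def ringCycles (n : ℕ) : SimpleGraph (RingVertex n) :=
  (SimpleGraph.cycleGraph n ⊕g SimpleGraph.cycleGraph n) ⊕g SimpleGraph.cycleGraph (2 * n)

/-- The perfect matching of `D_n` with the edges `v_i w_{2i}` and `u_i w_{2i+1}`. -/
def ringMatching (n : ℕ) : SimpleGraph (RingVertex n) :=
  SimpleGraph.fromRel fun a b => ∃ i : Fin n,
    (a = v i ∧ b = w ⟨2 * i.val, by omega⟩) ∨ (a = u i ∧ b = w ⟨2 * i.val + 1, by omega⟩)

/-- The graph `D_n`: three disjoint cycles and the matching between them. -/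
def ringGraph (n : ℕ) : SimpleGraph (RingVertex n) :=
  ringCycles n ⊔ ringMatching n

/-- The next vertex on the cycle `u_0 … u_{n-1}`, `v_0 … v_{n-1}` or `w_0 … w_{2n-1}`. -/
def next (n : ℕ) : RingVertex n → RingVertex n :=
  Sum.map (Sum.map (finRotate n) (finRotate n)) (finRotate (2 * n))

/-- On each of the three cycles, the edge to the next vertex is attached at the index `2m` and the
edge to the previous vertex at the index `0`. -/
def ringPort (n m : ℕ) (a b : RingVertex n) : Fin (2 * m + 1) :=
  if b = next n a then Fin.last (2 * m) else 0

/-- The graph `G(n, k) = D_n(M, H_{k-1})`. -/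
def gapGraph (n k : ℕ) : SimpleGraph (RingVertex n × Fin (2 * (k - 1) + 1)) :=
  replaceMatching (ringGraph n) (ringMatching n) (k - 1) (ringPort n (k - 1))

end CycleGap

/-!
Write `m = k - 1`, so that `G(n, k)` arises from `D_n` by replacing each of its vertices `a` by the
`2m + 1` vertices `(a, i)` of a chorded cycle. This replacement of `a` has three exits: at the
indices `0` and `2m` along the cycle of `D_n` through `a`, and at the index `m` along the matching.

*Cycle lengths.* A closed trail uses an even number of the edges of every cut, so it never uses
exactly one (`exists_second_edge_of_cut`); all bounds come from this. A cycle inside one replacement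
has at most `2m + 1 < 2k` vertices. Any other cycle has at least two vertices in each replacement
that it enters (`two_le_card_visits`), and at least `m + 1 = k` if it uses the matching edge there,
since it then has to climb through all levels `{i, 2m - i}` (`succ_le_card_visits`). If it uses a
matching edge, say at a vertex `u_i`, it uses a second one at another vertex `u_j`; this gives `4k`
vertices at the ends of the two edges, and at least two more at a further vertex of the cycle of the
`w_j`, because neighbours on this cycle have mates on different cycles (`le_length_of_mate`). If it
uses no matching edge, it follows a whole cycle of `D_n` (`le_length_of_next`) and has at least
`2n ≥ 8k + 4` vertices. The circumference bound follows, as in a 3-connected graph the edges between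
replacements lie on cycles.

*Planarity.* The vertices are put on a line in an order for which the edges can be distributed to
two pages, the half planes above and below the line, such that no two edges on a page have
interleaving ends; edges drawn as parabolas then do not cross (`IsPlanar.of_two_pages`).

*Connectivity.* From every vertex there are three paths, disjoint up to their first vertex, into the
replacements of the three neighbours of `a`. Hence every vertex outside a set `S` with `|S| ≤ 2` is
joined, off `S`, to a replacement that avoids `S` (`exists_joinedOff_clean`). Those replacements are
joined to each other because `D_n` is 3-connected (`ringGraph_joinedOff`).

Graphs `G(n, k)` for different `n` have different numbers of vertices.
-/

namespace CycleGap

variable {V : Type*}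

/-! ### Plane drawings from embeddings in a book with two pages -/

/-- The parabola over the `x`-axis with the zeros `a` and `b` and the leading coefficient `-ε`,
between its zeros; the inequality says that `p.1` lies between `a` and `b`, in either order. -/
def parabolicArc (ε a b : ℝ) : Set (ℝ × ℝ) :=
  {p | 0 ≤ (p.1 - a) * (b - p.1) ∧ p.2 = ε * ((p.1 - a) * (b - p.1))}

theorem mem_parabolicArc {ε a b x y : ℝ} :
    (x, y) ∈ parabolicArc ε a b ↔ 0 ≤ (x - a) * (b - x) ∧ y = ε * ((x - a) * (b - x)) :=
  Iff.rfl

theorem parabolicArc_comm (ε a b : ℝ) : parabolicArc ε a b = parabolicArc ε b a := by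
  ext ⟨x, y⟩
  rw [mem_parabolicArc, mem_parabolicArc, show (x - b) * (a - x) = (x - a) * (b - x) by ring]

theorem mem_parabolicArc_axis {ε a b x : ℝ} (h : (x, (0 : ℝ)) ∈ parabolicArc ε a b) (hε : ε ≠ 0) :
    x = a ∨ x = b := by
  have h := (mem_parabolicArc.1 h).2
  rw [zero_eq_mul, mul_eq_zero, or_iff_right hε, sub_eq_zero, sub_eq_zero] at h
  exact h.imp id Eq.symm

/-- A path along the parabola. -/
def parabolicPath (ε a b : ℝ) : Path ((a, 0) : ℝ × ℝ) (b, 0) where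
  toFun t := (a + t * (b - a), ε * ((t * (b - a)) * (b - a - t * (b - a))))
  continuous_toFun := by fun_prop
  source' := by simp
  target' := by simp

theorem parabolicPath_injective {ε a b : ℝ} (hab : a ≠ b) :
    Function.Injective (parabolicPath ε a b) := by
  intro s t h
  have h : a + s * (b - a) = a + t * (b - a) := congrArg Prod.fst h
  exact Subtype.ext (mul_right_cancel₀ (sub_ne_zero.2 hab.symm) (add_left_cancel h))

theorem range_parabolicPath {ε a b : ℝ} (hab : a ≠ b) :
    Set.range (parabolicPath ε a b) = parabolicArc ε a b := by
  have hd : b - a ≠ 0 := sub_ne_zero.2 hab.symm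
  ext ⟨x, y⟩
  constructor
  · rintro ⟨t, h⟩
    obtain ⟨rfl, rfl⟩ := Prod.mk.inj h
    refine ⟨?_, by ring⟩
    have h₀ := t.2.1
    have h₁ : 0 ≤ 1 - (t : ℝ) := sub_nonneg.2 t.2.2
    have : (a + t * (b - a) - a) * (b - (a + t * (b - a))) = t * (1 - t) * (b - a) ^ 2 := by ring
    show 0 ≤ (a + t * (b - a) - a) * (b - (a + t * (b - a)))
    rw [this]
    positivity
  · intro h
    obtain ⟨h₀, rfl⟩ := mem_parabolicArc.1 h
    have key : (x - a) * (b - x) = ((x - a) / (b - a)) * (1 - (x - a) / (b - a)) * (b - a) ^ 2 := by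
      field_simp
      ring
    have h : 0 ≤ ((x - a) / (b - a)) * (1 - (x - a) / (b - a)) := by
      rw [key] at h₀
      exact nonneg_of_mul_nonneg_left h₀ (by positivity)
    refine ⟨⟨(x - a) / (b - a), by nlinarith, by nlinarith⟩, ?_⟩
    refine Prod.ext ?_ ?_
    · change a + (x - a) / (b - a) * (b - a) = x
      field_simp
      ring
    · change ε * ((x - a) / (b - a) * (b - a) * (b - a - (x - a) / (b - a) * (b - a))) = _
      rw [div_mul_cancel₀ _ hd]
      ring

/-- Two different parabolas on the same side of the axis over intervals that do not interleave meet
only in a common zero. -/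
theorem parabolicArc_inter_same {ε a b c d : ℝ} (hε : ε ≠ 0) (hab : a < b) (hcd : c < d)
    (hne : a ≠ c ∨ b ≠ d) (h₁ : ¬(a < c ∧ c < b ∧ b < d)) (h₂ : ¬(c < a ∧ a < d ∧ d < b))
    {p : ℝ × ℝ} (hp : p ∈ parabolicArc ε a b) (hq : p ∈ parabolicArc ε c d) :
    p.2 = 0 ∧ (p.1 = a ∨ p.1 = b) ∧ (p.1 = c ∨ p.1 = d) := by
  obtain ⟨x, y⟩ := p
  obtain ⟨hp, rfl⟩ := mem_parabolicArc.1 hp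
  obtain ⟨hq, h⟩ := mem_parabolicArc.1 hq
  have h := mul_left_cancel₀ hε h
  simp only
  have hxa : a ≤ x := by nlinarith
  have hxb : x ≤ b := by nlinarith
  have hxc : c ≤ x := by nlinarith
  have hxd : x ≤ d := by nlinarith
  suffices (x = a ∨ x = b) ∧ (x = c ∨ x = d) by
    refine ⟨?_, this⟩
    rcases this.1 with rfl | rfl <;> simp
  -- the parabola over the larger of two nested intervals lies above the other one
  have nested : ∀ {a b c d : ℝ}, a < b → c ≤ a → b ≤ d → (a ≠ c ∨ b ≠ d) → a ≤ x → x ≤ b →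
      (x - a) * (b - x) = (x - c) * (d - x) → (x = a ∨ x = b) ∧ (x = c ∨ x = d) := by
    intro a b c d hab hca hbd hne hxa hxb h
    have e : (x - a) * (d - b) + (a - c) * (b - x) + (a - c) * (d - b) = 0 := by
      linear_combination -h
    have e₁ : 0 ≤ (x - a) * (d - b) := mul_nonneg (by linarith) (by linarith)
    have e₂ : 0 ≤ (a - c) * (b - x) := mul_nonneg (by linarith) (by linarith)
    have e₃ : 0 ≤ (a - c) * (d - b) := mul_nonneg (by linarith) (by linarith)
    have f₁ : (x - a) * (d - b) = 0 := by linarith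
    have f₂ : (a - c) * (b - x) = 0 := by linarith
    rw [mul_eq_zero, sub_eq_zero, sub_eq_zero] at f₁ f₂
    grind
  by_cases hbc : b ≤ c
  · have : x = b := by linarith
    have : x = c := by linarith
    exact ⟨Or.inr ‹_›, Or.inl ‹_›⟩
  by_cases hda : d ≤ a
  · have : x = a := by linarith
    have : x = d := by linarith
    exact ⟨Or.inl ‹_›, Or.inr ‹_›⟩
  push Not at hbc hda
  by_cases hca : c ≤ a ∧ b ≤ d
  · exact nested hab hca.1 hca.2 hne hxa hxb h
  · refine (nested hcd (a := c) (b := d) (c := a) (d := b) ?_ ?_ ?_ hxc hxd h.symm).symm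
    · grind
    · grind
    · exact hne.imp Ne.symm Ne.symm

theorem parabolicArc_inter_opposite {ε δ a b c d : ℝ} (hε : 0 < ε) (hδ : δ < 0)
    {p : ℝ × ℝ} (hp : p ∈ parabolicArc ε a b) (hq : p ∈ parabolicArc δ c d) :
    p.2 = 0 ∧ (p.1 = a ∨ p.1 = b) ∧ (p.1 = c ∨ p.1 = d) := by
  obtain ⟨x, y⟩ := p
  have h₁ : 0 ≤ y := by
    rw [(mem_parabolicArc.1 hp).2]; exact mul_nonneg hε.le hp.1
  have h₂ : y ≤ 0 := by
    rw [(mem_parabolicArc.1 hq).2]; exact mul_nonpos_of_nonpos_of_nonneg hδ.le hq.1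
  obtain rfl : y = 0 := le_antisymm h₂ h₁
  exact ⟨rfl, mem_parabolicArc_axis hp hε.ne', mem_parabolicArc_axis hq hδ.ne⟩

/-- A graph is planar if its vertices can be arranged on a line and its edges distributed among two
sets `A` and `B`, neither of which has interleaving edges: the edges in `A` are drawn above the
line and the others below. -/
theorem IsPlanar.of_two_pages {G : SimpleGraph V} (f : V → ℝ) (hf : Function.Injective f)
    (A B : V → V → Prop)
    (hG : ∀ p q, G.Adj p q → f p < f q → A p q ∨ B p q)
    (hA : ∀ a b c d, A a b → A c d → f a < f c → f c < f b → f b < f d → False)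
    (hB : ∀ a b c d, B a b → B c d → f a < f c → f c < f b → f b < f d → False) :
    IsPlanar G := by
  classical
  let P : Sym2 V → Prop := fun e => ∃ p q, e = s(p, q) ∧ f p < f q ∧ A p q
  let ε : Sym2 V → ℝ := fun e => if P e then 1 else -1
  have hε : ∀ e, ε e ≠ 0 := fun e => by simp only [ε]; split_ifs <;> norm_num
  have hP : ∀ p q, f p < f q → (P s(p, q) ↔ A p q) := by
    intro p q hpq
    constructor
    · rintro ⟨p', q', h, hlt, hA⟩
      rcases Sym2.eq_iff.1 h with ⟨rfl, rfl⟩ | ⟨rfl, rfl⟩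
      · exact hA
      · exact absurd hlt hpq.asymm
    · exact fun h => ⟨p, q, rfl, hpq, h⟩
  have hPB : ∀ p q, G.Adj p q → f p < f q → ¬P s(p, q) → B p q := fun p q h hlt hn =>
    (hG p q h hlt).resolve_left fun h' => hn ((hP p q hlt).2 h')
  let arc : Sym2 V → Set (ℝ × ℝ) := fun e =>
    Sym2.lift ⟨fun p q => parabolicArc (ε e) (f p) (f q), fun _ _ => parabolicArc_comm _ _ _⟩ e
  have orient : ∀ e ∈ G.edgeSet, ∃ p q, e = s(p, q) ∧ G.Adj p q ∧ f p < f q := by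
    intro e
    induction e with | _ p q
    intro h
    rcases lt_or_gt_of_ne (hf.ne (G.ne_of_adj h)) with h' | h'
    · exact ⟨p, q, rfl, h, h'⟩
    · exact ⟨q, p, Sym2.eq_swap, h.symm, h'⟩
  refine ⟨⟨fun p => (f p, 0), fun p q h => hf (Prod.mk.inj h).1, arc, ?_, ?_, ?_⟩⟩
  · intro p q h
    have hne := hf.ne (G.ne_of_adj h)
    exact ⟨parabolicPath (ε s(p, q)) (f p) (f q), parabolicPath_injective hne,
      range_parabolicPath hne⟩
  · intro e
    induction e with | _ p q
    intro _ x hx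
    rcases mem_parabolicArc_axis hx (hε _) with h | h
    · simp [hf h]
    · simp [hf h]
  · intro e he e' he' hne z hz
    obtain ⟨p, q, rfl, hpq, hlt⟩ := orient e he
    obtain ⟨p', q', rfl, hpq', hlt'⟩ := orient e' he'
    suffices z.2 = 0 ∧ (z.1 = f p ∨ z.1 = f q) ∧ (z.1 = f p' ∨ z.1 = f q') by
      obtain ⟨h₀, h, h'⟩ := this
      rcases h with h | h
      · refine ⟨p, by simp, ?_, Prod.ext h h₀⟩
        rcases h' with h' | h' <;> simp [hf (h.symm.trans h')]
      · refine ⟨q, by simp, ?_, Prod.ext h h₀⟩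
        rcases h' with h' | h' <;> simp [hf (h.symm.trans h')]
    have hz₁ : z ∈ parabolicArc (ε s(p, q)) (f p) (f q) := hz.1
    have hz₂ : z ∈ parabolicArc (ε s(p', q')) (f p') (f q') := hz.2
    have hne' : f p ≠ f p' ∨ f q ≠ f q' := by
      by_contra! h
      exact hne (by rw [hf h.1, hf h.2])
    by_cases h : P s(p, q) <;> by_cases h' : P s(p', q')
    · rw [show ε s(p', q') = ε s(p, q) by simp [ε, h, h']] at hz₂
      have hA₁ := (hP _ _ hlt).1 h
      have hA₂ := (hP _ _ hlt').1 h'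
      exact parabolicArc_inter_same (hε _) hlt hlt' hne'
        (fun ⟨x, y, z⟩ => hA _ _ _ _ hA₁ hA₂ x y z) (fun ⟨x, y, z⟩ => hA _ _ _ _ hA₂ hA₁ x y z)
        hz₁ hz₂
    · exact parabolicArc_inter_opposite (by simp [ε, h]) (by simp [ε, h']) hz₁ hz₂
    · have := parabolicArc_inter_opposite (by simp [ε, h']) (by simp [ε, h]) hz₂ hz₁
      exact ⟨this.1, this.2.2, this.2.1⟩
    · rw [show ε s(p', q') = ε s(p, q) by simp [ε, h, h']] at hz₂
      have hB₁ := hPB _ _ hpq hlt h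
      have hB₂ := hPB _ _ hpq' hlt' h'
      exact parabolicArc_inter_same (hε _) hlt hlt' hne'
        (fun ⟨x, y, z⟩ => hB _ _ _ _ hB₁ hB₂ x y z) (fun ⟨x, y, z⟩ => hB _ _ _ _ hB₂ hB₁ x y z)
        hz₁ hz₂

open SimpleGraph

/-! ### The adjacency of the gadgets and of the ring graph -/

theorem finRotate_val {n : ℕ} (i : Fin n) :
    (finRotate n i).val = if i.val + 1 = n then 0 else i.val + 1 := by
  obtain _ | n := n
  · exact i.elim0
  · rw [coe_finRotate]
    simp [Fin.ext_iff]

theorem cycleGraph_adj_iff_finRotate {n : ℕ} (hn : 2 ≤ n) (i j : Fin n) :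
    (cycleGraph n).Adj i j ↔ j = finRotate n i ∨ i = finRotate n j := by
  obtain ⟨n, rfl⟩ := Nat.exists_eq_add_of_le' hn
  rw [cycleGraph_adj, finRotate_apply, finRotate_apply, sub_eq_iff_eq_add', sub_eq_iff_eq_add',
    or_comm]

theorem chordedCycle_adj {m : ℕ} (hm : 1 ≤ m) (i j : Fin (2 * m + 1)) :
    (chordedCycle m).Adj i j ↔
      i.val + 1 = j.val ∨ j.val + 1 = i.val ∨ (i.val ≠ j.val ∧ i.val + j.val = 2 * m) := by
  rw [chordedCycle, sup_adj, cycleGraph_adj_iff_finRotate (by omega), fromRel_adj, Fin.ext_iff,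
    Fin.ext_iff, finRotate_val, finRotate_val, ne_eq, Fin.ext_iff]
  split_ifs <;> omega

/-- The neighbour of a vertex of `D_n` along the perfect matching. -/
def mate {n : ℕ} : RingVertex n → RingVertex n
  | .inl (.inl i) => w ⟨2 * i.val + 1, by omega⟩
  | .inl (.inr i) => w ⟨2 * i.val, by omega⟩
  | .inr j => if j.val % 2 = 0 then v ⟨j.val / 2, by omega⟩ else u ⟨j.val / 2, by omega⟩

/-- The previous vertex on the cycle `u_0 … u_{n-1}`, `v_0 … v_{n-1}` or `w_0 … w_{2n-1}`. -/
def prev (n : ℕ) : RingVertex n → RingVertex n :=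
  Sum.map (Sum.map (finRotate n).symm (finRotate n).symm) (finRotate (2 * n)).symm

@[simp] theorem next_u {n : ℕ} (i : Fin n) : next n (u i) = u (finRotate n i) := rfl
@[simp] theorem next_v {n : ℕ} (i : Fin n) : next n (v i) = v (finRotate n i) := rfl
@[simp] theorem next_w {n : ℕ} (j : Fin (2 * n)) : next n (w j) = w (finRotate (2 * n) j) := rfl
@[simp] theorem prev_u {n : ℕ} (i : Fin n) : prev n (u i) = u ((finRotate n).symm i) := rfl
@[simp] theorem prev_v {n : ℕ} (i : Fin n) : prev n (v i) = v ((finRotate n).symm i) := rfl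
@[simp] theorem prev_w {n : ℕ} (j : Fin (2 * n)) :
    prev n (w j) = w ((finRotate (2 * n)).symm j) := rfl
@[simp] theorem mate_u {n : ℕ} (i : Fin n) : mate (u i) = w ⟨2 * i.val + 1, by omega⟩ := rfl
@[simp] theorem mate_v {n : ℕ} (i : Fin n) : mate (v i) = w ⟨2 * i.val, by omega⟩ := rfl

theorem mate_w {n : ℕ} (j : Fin (2 * n)) :
    mate (w j) = if j.val % 2 = 0 then v ⟨j.val / 2, by omega⟩ else u ⟨j.val / 2, by omega⟩ := rfl

@[simp] theorem u_inj {n : ℕ} {i j : Fin n} : u i = u j ↔ i = j := by simp [u]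
@[simp] theorem v_inj {n : ℕ} {i j : Fin n} : v i = v j ↔ i = j := by simp [v]
@[simp] theorem w_inj {n : ℕ} {i j : Fin (2 * n)} : w i = w j ↔ i = j := by simp [w]
@[simp] theorem u_ne_v {n : ℕ} {i j : Fin n} : u i ≠ v j := by simp [u, v]
@[simp] theorem v_ne_u {n : ℕ} {i j : Fin n} : v i ≠ u j := by simp [u, v]
@[simp] theorem u_ne_w {n : ℕ} {i : Fin n} {j : Fin (2 * n)} : u i ≠ w j := by simp [u, w]
@[simp] theorem v_ne_w {n : ℕ} {i : Fin n} {j : Fin (2 * n)} : v i ≠ w j := by simp [v, w]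
@[simp] theorem w_ne_u {n : ℕ} {i : Fin n} {j : Fin (2 * n)} : w j ≠ u i := by simp [u, w]
@[simp] theorem w_ne_v {n : ℕ} {i : Fin n} {j : Fin (2 * n)} : w j ≠ v i := by simp [v, w]

theorem ringVertex_cases {n : ℕ} {P : RingVertex n → Prop} (hu : ∀ i, P (u i))
    (hv : ∀ i, P (v i)) (hw : ∀ j, P (w j)) (a : RingVertex n) : P a := by
  rcases a with (i | i) | j
  exacts [hu i, hv i, hw j]

@[simp] theorem next_prev {n : ℕ} (a : RingVertex n) : next n (prev n a) = a := by
  induction a using ringVertex_cases <;> simp [-finRotate_symm_apply, -finRotate_apply]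

@[simp] theorem prev_next {n : ℕ} (a : RingVertex n) : prev n (next n a) = a := by
  induction a using ringVertex_cases <;> simp [-finRotate_symm_apply, -finRotate_apply]

theorem eq_next_iff {n : ℕ} {a b : RingVertex n} : a = next n b ↔ b = prev n a := by
  constructor <;> rintro rfl <;> simp

@[simp] theorem mate_mate {n : ℕ} (a : RingVertex n) : mate (mate a) = a := by
  induction a using ringVertex_cases with
  | hu i => simp [mate_w, show (2 * i.val + 1) / 2 = i.val by omega]
  | hv i => simp [mate_w]
  | hw j =>
    rw [mate_w]
    split_ifs <;> simp only [mate_u, mate_v, w_inj, Fin.ext_iff] <;> omega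

theorem mate_injective {n : ℕ} : Function.Injective (mate (n := n)) :=
  Function.LeftInverse.injective (g := mate) mate_mate

theorem mate_ne {n : ℕ} (a : RingVertex n) : mate a ≠ a := by
  induction a using ringVertex_cases with
  | hu i => simp
  | hv i => simp
  | hw j => rw [mate_w]; split_ifs <;> simp

theorem mate_ne_next {n : ℕ} (a : RingVertex n) : mate a ≠ next n a := by
  induction a using ringVertex_cases with
  | hu i => simp
  | hv i => simp
  | hw j => rw [mate_w]; split_ifs <;> simp

theorem mate_ne_prev {n : ℕ} (a : RingVertex n) : mate a ≠ prev n a := by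
  intro h
  apply mate_ne_next (mate a)
  rw [mate_mate, h, next_prev]

theorem next_ne {n : ℕ} (hn : 3 ≤ n) (a : RingVertex n) : next n a ≠ a := by
  induction a using ringVertex_cases <;>
    · simp only [next_u, next_v, next_w, ne_eq, u_inj, v_inj, w_inj, Fin.ext_iff, finRotate_val]
      split_ifs <;> omega

theorem next_next_ne {n : ℕ} (hn : 3 ≤ n) (a : RingVertex n) : next n (next n a) ≠ a := by
  induction a using ringVertex_cases <;>
    · simp only [next_u, next_v, next_w, ne_eq, u_inj, v_inj, w_inj, Fin.ext_iff, finRotate_val]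
      split_ifs <;> omega

theorem prev_ne {n : ℕ} (hn : 3 ≤ n) (a : RingVertex n) : prev n a ≠ a :=
  fun h => next_ne hn a (by conv_lhs => rw [← h, next_prev])

theorem next_ne_prev {n : ℕ} (hn : 3 ≤ n) (a : RingVertex n) : next n a ≠ prev n a :=
  fun h => next_next_ne hn a (by rw [h, next_prev])

theorem ringMatching_adj {n : ℕ} {a b : RingVertex n} :
    (ringMatching n).Adj a b ↔ b = mate a := by
  rw [ringMatching, fromRel_adj]
  constructor
  · rintro ⟨-, ⟨i, ⟨rfl, rfl⟩ | ⟨rfl, rfl⟩⟩ | ⟨i, ⟨rfl, rfl⟩ | ⟨rfl, rfl⟩⟩⟩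
    · rfl
    · rfl
    · rw [← mate_v, mate_mate]
    · rw [← mate_u, mate_mate]
  · rintro rfl
    refine ⟨(mate_ne a).symm, ?_⟩
    induction a using ringVertex_cases with
    | hu i => exact Or.inl ⟨i, Or.inr ⟨rfl, rfl⟩⟩
    | hv i => exact Or.inl ⟨i, Or.inl ⟨rfl, rfl⟩⟩
    | hw j =>
      refine Or.inr ⟨⟨j.val / 2, by omega⟩, ?_⟩
      rw [mate_w]
      split_ifs with h <;> simp [Fin.ext_iff] <;> omega

theorem ringCycles_adj {n : ℕ} (hn : 3 ≤ n) {a b : RingVertex n} :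
    (ringCycles n).Adj a b ↔ b = next n a ∨ a = next n b := by
  induction a using ringVertex_cases <;> induction b using ringVertex_cases <;>
    first
    | simp only [next_u, next_v, next_w, u_inj, v_inj, w_inj]
      rw [← cycleGraph_adj_iff_finRotate (by omega)]
      simp [ringCycles, u, v, w]
    | simp [ringCycles]; simp [u, v, w]

theorem ringGraph_adj {n : ℕ} (hn : 3 ≤ n) {a b : RingVertex n} :
    (ringGraph n).Adj a b ↔ b = next n a ∨ a = next n b ∨ b = mate a := by
  rw [ringGraph, sup_adj, ringCycles_adj hn, ringMatching_adj, or_assoc]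

/-- The graph `D_n(M, H_m)`. -/
abbrev replacedRing (n m : ℕ) : SimpleGraph (RingVertex n × Fin (2 * m + 1)) :=
  replaceMatching (ringGraph n) (ringMatching n) m (ringPort n m)

/-- The edges of `D_n(M, H_m)`: those inside the `2m + 1` vertices that replace a vertex of `D_n`,
the edges `x_m y_m` along `M`, and the edges along the three cycles. -/
theorem replacedRing_adj {n m : ℕ} (hn : 3 ≤ n) {p q : RingVertex n × Fin (2 * m + 1)} :
    (replacedRing n m).Adj p q ↔
      (p.1 = q.1 ∧ (chordedCycle m).Adj p.2 q.2) ∨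
      (q.1 = mate p.1 ∧ p.2 = mid m ∧ q.2 = mid m) ∨
      (q.1 = next n p.1 ∧ p.2 = Fin.last (2 * m) ∧ q.2 = 0) ∨
      (p.1 = next n q.1 ∧ q.2 = Fin.last (2 * m) ∧ p.2 = 0) := by
  obtain ⟨a, i⟩ := p
  obtain ⟨b, j⟩ := q
  constructor
  · rintro (⟨e, he, ⟨s, i'⟩, ⟨t, j'⟩, h, hp, hq⟩ | ⟨hD, hM, hi, hj⟩)
    · rw [ringMatching_adj] at he
      simp only [Prod.mk.injEq] at hp hq
      obtain ⟨rfl, rfl⟩ := hp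
      obtain ⟨rfl, rfl⟩ := hq
      rcases h with ⟨hst, h⟩ | ⟨hst, h⟩
      · simp only at hst
        subst hst
        exact Or.inl ⟨rfl, h⟩
      · refine Or.inr (Or.inl ⟨?_, h⟩)
        cases s <;> cases t <;> simp_all
    · simp only [ringGraph_adj hn, ringMatching_adj] at hD hM hi hj
      rcases hD with rfl | rfl | h
      · refine Or.inr (Or.inr (Or.inl ⟨rfl, ?_, ?_⟩))
        · simpa [ringPort] using hi
        · simpa [ringPort, (next_next_ne hn a).symm] using hj
      · refine Or.inr (Or.inr (Or.inr ⟨rfl, ?_, ?_⟩))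
        · simpa [ringPort] using hj
        · simpa [ringPort, (next_next_ne hn b).symm] using hi
      · exact absurd h hM
  · rintro (⟨hab, h⟩ | ⟨hab, h⟩ | ⟨hab, h⟩ | ⟨hab, h⟩) <;> simp only at hab h <;> subst hab
    · refine Or.inl ⟨fun x => bif x then mate a else a, ringMatching_adj.2 rfl,
        (false, i), (false, j), Or.inl ⟨rfl, h⟩, rfl, rfl⟩
    · refine Or.inl ⟨fun x => bif x then mate a else a, ringMatching_adj.2 rfl,
        (false, i), (true, j), Or.inr ⟨by simp, h⟩, rfl, rfl⟩
    · refine Or.inr ⟨(ringGraph_adj hn).2 (Or.inl rfl), ?_, ?_⟩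
      · rw [ringMatching_adj]
        exact (mate_ne_next a).symm
      · simpa [ringPort, (next_next_ne hn a).symm] using h
    · refine Or.inr ⟨(ringGraph_adj hn).2 (Or.inr (Or.inl rfl)), ?_, ?_⟩
      · rw [ringMatching_adj, eq_comm]
        intro h'
        exact mate_ne_prev (next n b) (by rw [h', prev_next])
      · simpa [ringPort, (next_next_ne hn b).symm, and_comm] using h

/-! ### Planarity -/

/-- The place of a vertex of `D_n` in the order
`w_0, v_0, …, v_{n-1}, w_{2n-1}, …, w_1, u_0, …, u_{n-1}`. -/
def block {n : ℕ} : RingVertex n → ℕ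
  | .inl (.inl i) => 3 * n + i.val
  | .inl (.inr i) => 1 + i.val
  | .inr j => if j.val = 0 then 0 else 3 * n - j.val

/-- The place of the vertex with the index `i` among those that replace a vertex of `D_n`: the
order of the indices is reversed at the vertices `w_j`. -/
def offset {n m : ℕ} : RingVertex n → Fin (2 * m + 1) → ℕ
  | .inl _, i => i.val
  | .inr _, i => 2 * m - i.val

/-- The place of a vertex on the line of the embedding with two pages. -/
def place {n m : ℕ} (p : RingVertex n × Fin (2 * m + 1)) : ℕ :=
  block p.1 * (2 * m + 1) + offset p.1 p.2

@[simp] theorem block_u {n : ℕ} (i : Fin n) : block (u i) = 3 * n + i.val := rfl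
@[simp] theorem block_v {n : ℕ} (i : Fin n) : block (v i) = 1 + i.val := rfl
theorem block_w {n : ℕ} (j : Fin (2 * n)) :
    block (w j) = if j.val = 0 then 0 else 3 * n - j.val := rfl
@[simp] theorem offset_u {n m : ℕ} (i : Fin n) (l : Fin (2 * m + 1)) :
    offset (u i) l = l.val := rfl
@[simp] theorem offset_v {n m : ℕ} (i : Fin n) (l : Fin (2 * m + 1)) :
    offset (v i) l = l.val := rfl
@[simp] theorem offset_w {n m : ℕ} (j : Fin (2 * n)) (l : Fin (2 * m + 1)) :
    offset (w j) l = 2 * m - l.val := rfl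

@[simp] theorem mid_val (m : ℕ) : (mid m).val = m := rfl

theorem offset_lt {n m : ℕ} (a : RingVertex n) (l : Fin (2 * m + 1)) : offset a l < 2 * m + 1 := by
  induction a using ringVertex_cases <;> simp <;> omega

theorem block_injective {n : ℕ} : Function.Injective (block (n := n)) := by
  intro a b h
  induction a using ringVertex_cases <;> induction b using ringVertex_cases <;>
    simp only [block_u, block_v, block_w, u_inj, v_inj, w_inj, Fin.ext_iff] at h ⊢ <;>
    (try split_ifs at h) <;> omega

theorem offset_injective {n m : ℕ} (a : RingVertex n) :
    Function.Injective (offset (m := m) a) := by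
  intro i j h
  rw [Fin.ext_iff]
  induction a using ringVertex_cases <;> simp at h <;> omega

theorem place_lt_iff {n m : ℕ} {p q : RingVertex n × Fin (2 * m + 1)} :
    place p < place q ↔
      block p.1 < block q.1 ∨ (block p.1 = block q.1 ∧ offset p.1 p.2 < offset q.1 q.2) := by
  have hp := offset_lt p.1 p.2
  have hq := offset_lt q.1 q.2
  rw [place, place]
  rcases lt_trichotomy (block p.1) (block q.1) with h | h | h
  · have := Nat.mul_le_mul_right (2 * m + 1) (Nat.succ_le_of_lt h)
    rw [Nat.succ_mul] at this
    omega
  · rw [h]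
    omega
  · have := Nat.mul_le_mul_right (2 * m + 1) (Nat.succ_le_of_lt h)
    rw [Nat.succ_mul] at this
    omega

theorem place_injective {n m : ℕ} : Function.Injective (place (n := n) (m := m)) := by
  intro p q h
  have h₁ := place_lt_iff.not.1 h.not_lt
  have h₂ := place_lt_iff.not.1 h.not_gt
  have h₃ : p.1 = q.1 := block_injective (by omega)
  refine Prod.ext h₃ (offset_injective p.1 ?_)
  rw [← h₃] at h₁ h₂
  omega

/-- The edges above the line, by the blocks `B`, `C` and the offsets `s`, `t` of their ends: edges
inside the blocks of the `u_i` and of the `w_j` with `j` odd, the edges of `M` at the `v_i`, the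
edge along `w_0w_1`, the edge along `u_0u_{n-1}`, and edges between consecutive places. -/
def PageAbove (n m B s C t : ℕ) : Prop :=
  (B = C ∧ s + t = 2 * m ∧ (3 * n ≤ B ∨ (n + 1 ≤ B ∧ B < 3 * n ∧ (3 * n - B) % 2 = 1))) ∨
  (2 ≤ B ∧ B ≤ n ∧ C + 2 * B = 3 * n + 2 ∧ s = m ∧ t = m) ∨
  (B = 0 ∧ C = 1 ∧ s = m ∧ t = m) ∨
  (B = 0 ∧ C = 3 * n - 1 ∧ s = 0 ∧ t = 2 * m) ∨
  (B = 3 * n ∧ C = 4 * n - 1 ∧ s = 0 ∧ t = 2 * m) ∨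
  (B = C ∧ t = s + 1) ∨
  (C = B + 1 ∧ s = 2 * m ∧ t = 0)

/-- The edges below the line, by the blocks `B`, `C` and the offsets `s`, `t` of their ends: edges
inside the blocks of the `v_i` and of the `w_j` with `j` even, the edges of `M` at the `u_i`, the
edge along `v_0v_{n-1}`, and the edge along `w_0w_{2n-1}`. -/
def PageBelow (n m B s C t : ℕ) : Prop :=
  (B = C ∧ s + t = 2 * m ∧ (B ≤ n ∨ (n + 1 ≤ B ∧ B < 3 * n ∧ (3 * n - B) % 2 = 0))) ∨
  (3 * n ≤ C ∧ C < 4 * n ∧ B + 2 * C + 1 = 9 * n ∧ s = m ∧ t = m) ∨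
  (B = 1 ∧ C = n ∧ s = 0 ∧ t = 2 * m) ∨
  (B = 0 ∧ C = n + 1 ∧ s = 2 * m ∧ t = 0)

theorem pageAbove_not_interleaving {n m B s C t B' s' C' t' : ℕ} (hn : 3 ≤ n) (hm : 1 ≤ m)
    (ht : t ≤ 2 * m) (ht' : t' ≤ 2 * m)
    (h : PageAbove n m B s C t) (h' : PageAbove n m B' s' C' t')
    (h₁ : B < B' ∨ (B = B' ∧ s < s')) (h₂ : B' < C ∨ (B' = C ∧ s' < t))
    (h₃ : C < C' ∨ (C = C' ∧ t < t')) : False := by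
  rcases h with h | h | h | h | h | h | h <;>
    rcases h' with h' | h' | h' | h' | h' | h' | h' <;> omega

theorem pageBelow_not_interleaving {n m B s C t B' s' C' t' : ℕ} (hn : 3 ≤ n) (hm : 1 ≤ m)
    (h : PageBelow n m B s C t) (h' : PageBelow n m B' s' C' t')
    (h₁ : B < B' ∨ (B = B' ∧ s < s')) (h₂ : B' < C ∨ (B' = C ∧ s' < t))
    (h₃ : C < C' ∨ (C = C' ∧ t < t')) : False := by
  rcases h with h | h | h | h <;> rcases h' with h' | h' | h' | h' <;> omega

/-- Every edge lies on one of the two pages. -/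
theorem pageAbove_or_pageBelow {n m : ℕ} (hn : 3 ≤ n) (hm : 1 ≤ m)
    {p q : RingVertex n × Fin (2 * m + 1)}
    (h : (replacedRing n m).Adj p q)
    (hlt : place p < place q) :
    PageAbove n m (block p.1) (offset p.1 p.2) (block q.1) (offset q.1 q.2) ∨
      PageBelow n m (block p.1) (offset p.1 p.2) (block q.1) (offset q.1 q.2) := by
  obtain ⟨a, i⟩ := p
  obtain ⟨b, j⟩ := q
  rw [place_lt_iff] at hlt
  rw [replacedRing_adj hn] at h
  simp only [chordedCycle_adj hm] at h hlt ⊢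
  have hi := i.is_lt
  have hj := j.is_lt
  simp only [PageAbove, PageBelow]
  rcases h with ⟨rfl, h⟩ | ⟨rfl, rfl, rfl⟩ | ⟨rfl, rfl, rfl⟩ | ⟨rfl, rfl, rfl⟩
  · have page : (3 * n ≤ block a ∨ (n + 1 ≤ block a ∧ block a < 3 * n ∧
          (3 * n - block a) % 2 = 1)) ∨
        (block a ≤ n ∨ (n + 1 ≤ block a ∧ block a < 3 * n ∧ (3 * n - block a) % 2 = 0)) := by
      omega
    have ends : (offset a i = i.val ∧ offset a j = j.val) ∨
        (offset a i = 2 * m - i.val ∧ offset a j = 2 * m - j.val) := by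
      induction a using ringVertex_cases <;> simp
    have chord : offset a j = offset a i + 1 ∨ offset a i + offset a j = 2 * m := by omega
    rcases chord with h | h
    · exact Or.inl (Or.inr (Or.inr (Or.inr (Or.inr (Or.inr (Or.inl ⟨rfl, h⟩))))))
    · rcases page with h' | h'
      · exact Or.inl (Or.inl ⟨rfl, h, h'⟩)
      · exact Or.inr (Or.inl ⟨rfl, h, h'⟩)
  · induction a using ringVertex_cases with
    | hu i =>
      simp only [mate_u, block_u, block_w, offset_u, offset_w, mid,
        Nat.add_eq_zero_iff, one_ne_zero, and_false, if_false] at hlt ⊢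
      exfalso; omega
    | hv i =>
      left
      simp only [mate_v, block_v, block_w, offset_v, offset_w, mid_val, true_and] at hlt ⊢
      split_ifs at hlt ⊢
      · exfalso; omega
      · right; left; omega
    | hw j =>
      rw [mate_w] at hlt ⊢
      split_ifs at hlt ⊢ with h
      · left
        simp only [block_v, block_w, offset_v, offset_w, mid_val, and_true] at hlt ⊢
        split_ifs at hlt ⊢
        · right; right; left; omega
        · exfalso; omega
      · right; right; left
        simp only [block_u, block_w, offset_u, offset_w, mid_val, and_true] at hlt ⊢
        split_ifs at hlt ⊢ <;> omega
  · induction a using ringVertex_cases with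
    | hu i =>
      left
      simp only [next_u, block_u, offset_u, Fin.val_last, Fin.val_zero, finRotate_val,
        and_true] at hlt ⊢
      split_ifs at hlt ⊢
      · exfalso; omega
      · right; right; right; right; right; right; omega
    | hv i =>
      left
      simp only [next_v, block_v, offset_v, Fin.val_last, Fin.val_zero, finRotate_val,
        and_true] at hlt ⊢
      split_ifs at hlt ⊢
      · exfalso; omega
      · right; right; right; right; right; right; omega
    | hw j =>
      simp only [next_w, block_w, offset_w, Fin.val_last, Fin.val_zero, finRotate_val] at hlt ⊢
      by_cases h₀ : j.val = 0
      · have h₁ : j.val + 1 ≠ 2 * n := by omega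
        rw [if_neg h₁, if_pos h₀, if_neg (by omega)] at hlt ⊢
        left; right; right; right; left; omega
      · exfalso
        rw [if_neg h₀] at hlt
        split_ifs at hlt <;> omega
  · induction b using ringVertex_cases with
    | hu i =>
      simp only [next_u, block_u, offset_u, Fin.val_last, Fin.val_zero, finRotate_val,
        and_true] at hlt ⊢
      split_ifs at hlt ⊢
      · left; right; right; right; right; left; omega
      · exfalso; omega
    | hv i =>
      simp only [next_v, block_v, offset_v, Fin.val_last, Fin.val_zero, finRotate_val,
        and_true] at hlt ⊢
      split_ifs at hlt ⊢
      · right; right; right; left; omega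
      · exfalso; omega
    | hw j =>
      simp only [next_w, block_w, offset_w, Fin.val_last, Fin.val_zero, finRotate_val] at hlt ⊢
      by_cases h₀ : j.val = 0
      · exfalso
        rw [if_pos h₀] at hlt
        split_ifs at hlt <;> omega
      · by_cases h₁ : j.val + 1 = 2 * n
        · rw [if_pos h₁, if_neg h₀, if_pos rfl] at hlt ⊢
          right; right; right; right; omega
        · rw [if_neg h₁, if_neg h₀, if_neg (by omega)] at hlt ⊢
          left; right; right; right; right; right; right; omega

theorem isPlanar_replacedRing {n m : ℕ} (hn : 3 ≤ n) (hm : 1 ≤ m) :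
    IsPlanar (replacedRing n m) := by
  have ho : ∀ p : RingVertex n × Fin (2 * m + 1), offset p.1 p.2 ≤ 2 * m :=
    fun p => Nat.le_of_lt_succ (offset_lt p.1 p.2)
  refine IsPlanar.of_two_pages (fun p => (place p : ℝ)) (Nat.cast_injective.comp place_injective)
    (fun p q => PageAbove n m (block p.1) (offset p.1 p.2) (block q.1) (offset q.1 q.2))
    (fun p q => PageBelow n m (block p.1) (offset p.1 p.2) (block q.1) (offset q.1 q.2))
    (fun p q h hlt => pageAbove_or_pageBelow hn hm h (by exact_mod_cast hlt)) ?_ ?_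
  · intro a b c d hab hcd h₁ h₂ h₃
    exact pageAbove_not_interleaving hn hm (ho b) (ho d) hab hcd
      (place_lt_iff.1 (by exact_mod_cast h₁)) (place_lt_iff.1 (by exact_mod_cast h₂))
      (place_lt_iff.1 (by exact_mod_cast h₃))
  · intro a b c d hab hcd h₁ h₂ h₃
    exact pageBelow_not_interleaving hn hm hab hcd
      (place_lt_iff.1 (by exact_mod_cast h₁)) (place_lt_iff.1 (by exact_mod_cast h₂))
      (place_lt_iff.1 (by exact_mod_cast h₃))

/-! ### Degrees -/

theorem isCubic_replacedRing {n m : ℕ} (hn : 3 ≤ n) (hm : 1 ≤ m) :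
    IsCubic (replacedRing n m) := by
  classical
  rintro ⟨a, i⟩
  have hi := i.is_lt
  have h₁ := mate_ne a
  have h₂ := next_ne hn a
  have h₃ := prev_ne hn a
  rw [← card_neighborFinset_eq_degree, Finset.card_eq_three]
  simp only [Finset.ext_iff, mem_neighborFinset, replacedRing_adj hn, Finset.mem_insert,
    Finset.mem_singleton, Prod.forall, chordedCycle_adj hm, eq_next_iff (a := a)]
  by_cases h0 : i.val = 0
  · refine ⟨(a, ⟨1, by omega⟩), (a, Fin.last _), (prev n a, Fin.last _), ?_, ?_, ?_, ?_⟩ <;>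
      simp only [ne_eq, Prod.mk.injEq, Fin.ext_iff, Fin.val_last, Fin.val_zero, mid]
    · omega
    · exact fun h => h₃ h.1.symm
    · exact fun h => h₃ h.1.symm
    · grind
  by_cases hl : i.val = 2 * m
  · refine ⟨(a, ⟨2 * m - 1, by omega⟩), (a, 0), (next n a, 0), ?_, ?_, ?_, ?_⟩ <;>
      simp only [ne_eq, Prod.mk.injEq, Fin.ext_iff, Fin.val_last, Fin.val_zero, mid]
    · omega
    · exact fun h => h₂ h.1.symm
    · exact fun h => h₂ h.1.symm
    · grind
  by_cases hc : i.val = m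
  · refine ⟨(a, ⟨m - 1, by omega⟩), (a, ⟨m + 1, by omega⟩), (mate a, mid m), ?_, ?_, ?_, ?_⟩ <;>
      simp only [ne_eq, Prod.mk.injEq, Fin.ext_iff, Fin.val_last, Fin.val_zero, mid]
    · omega
    · exact fun h => h₁ h.1.symm
    · exact fun h => h₁ h.1.symm
    · grind
  · refine ⟨(a, ⟨i.val - 1, by omega⟩), (a, ⟨i.val + 1, by omega⟩), (a, ⟨2 * m - i.val, by omega⟩),
      ?_, ?_, ?_, ?_⟩ <;>
      simp only [ne_eq, Prod.mk.injEq, Fin.ext_iff, Fin.val_last, Fin.val_zero, mid]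
    · omega
    · omega
    · omega
    · grind

/-! ### Connectivity -/

/-- Reachability of `y` from `x` in `G - S`, as a relation on the vertices of `G`; it holds for
`x = y` whether or not `x` belongs to `S`. -/
def JoinedOff (G : SimpleGraph V) (S : Set V) : V → V → Prop :=
  Relation.ReflTransGen fun x y => G.Adj x y ∧ x ∉ S ∧ y ∉ S

namespace JoinedOff

variable {G : SimpleGraph V} {S : Set V} {x y z : V}

theorem refl (x : V) : JoinedOff G S x x := Relation.ReflTransGen.refl

theorem trans (h : JoinedOff G S x y) (h' : JoinedOff G S y z) : JoinedOff G S x z :=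
  Relation.ReflTransGen.trans h h'

theorem symm (h : JoinedOff G S x y) : JoinedOff G S y x := by
  induction h with
  | refl => exact refl _
  | tail _ h ih => exact .head ⟨h.1.symm, h.2.2, h.2.1⟩ ih

theorem of_adj (h : G.Adj x y) (hx : x ∉ S) (hy : y ∉ S) : JoinedOff G S x y :=
  .single ⟨h, hx, hy⟩

theorem reachable (h : JoinedOff G S x y) (hx : x ∉ S) (hy : y ∉ S) :
    (G.induce {z | z ∉ S}).Reachable ⟨x, hx⟩ ⟨y, hy⟩ := by
  induction h with
  | refl => exact Reachable.refl _
  | tail _ h ih => exact (ih h.2.1).trans (Adj.reachable (by simpa using h.1))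

end JoinedOff

/-- Of three disjoint sets, one avoids a given set of at most two elements. -/
theorem exists_avoid {B : Finset V} (hB : B.card ≤ 2) {P Q R : Set V} (hPQ : Disjoint P Q)
    (hPR : Disjoint P R) (hQR : Disjoint Q R) :
    (∀ x ∈ P, x ∉ B) ∨ (∀ x ∈ Q, x ∉ B) ∨ (∀ x ∈ R, x ∉ B) := by
  classical
  by_contra! h
  obtain ⟨⟨p, hp, hp'⟩, ⟨q, hq, hq'⟩, ⟨r, hr, hr'⟩⟩ := h
  have hc : ({p, q, r} : Finset V).card = 3 :=
    Finset.card_eq_three.2 ⟨p, q, r, hPQ.ne_of_mem hp hq, hPR.ne_of_mem hp hr,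
      hQR.ne_of_mem hq hr, rfl⟩
  have hs : ({p, q, r} : Finset V) ⊆ B := by
    intro x hx
    simp only [Finset.mem_insert, Finset.mem_singleton] at hx
    rcases hx with rfl | rfl | rfl <;> assumption
  have := Finset.card_le_card hs
  omega

/-- A property of the elements of `Fin N` that is inherited by the cyclic successor holds for
all of them as soon as it holds for one. -/
theorem forall_of_finRotate {N : ℕ} {P : Fin N → Prop} {i : Fin N} (hi : P i)
    (step : ∀ j, P j → P (finRotate N j)) (j : Fin N) : P j := by
  have := i.neZero
  have h : ∀ t : ℕ, P (i + Fin.ofNat N t) := by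
    intro t
    induction t with
    | zero => simpa using hi
    | succ t ih =>
      have := step _ ih
      rw [finRotate_apply, add_assoc] at this
      convert this using 2
      simp [Fin.ext_iff, Fin.val_add]
  have := h (j - i).val
  simpa using this

section Ring

variable {n : ℕ} {B : Finset (RingVertex n)}

/-- The vertex `w_{2i}`. -/
abbrev wEven (i : Fin n) : RingVertex n := mate (v i)

/-- The vertex `w_{2i+1}`. -/
abbrev wOdd (i : Fin n) : RingVertex n := mate (u i)

theorem next_wEven (i : Fin n) : next n (wEven i) = wOdd i := by
  simp only [mate_v, mate_u, next_w, w_inj, Fin.ext_iff, finRotate_val]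
  rw [if_neg (by omega)]

theorem next_wOdd (i : Fin n) : next n (wOdd i) = wEven (finRotate n i) := by
  simp only [mate_v, mate_u, next_w, w_inj, Fin.ext_iff, finRotate_val]
  split_ifs <;> omega

theorem ringVertex_cases' {P : RingVertex n → Prop} (hu : ∀ i, P (u i))
    (hv : ∀ i, P (v i)) (he : ∀ j, P (wEven j)) (ho : ∀ j, P (wOdd j))
    (a : RingVertex n) : P a := by
  induction a using ringVertex_cases with
  | hu i => exact hu i
  | hv i => exact hv i
  | hw j =>
    rcases Nat.even_or_odd' j.val with ⟨l, h | h⟩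
    · convert he ⟨l, by omega⟩
      simp [Fin.ext_iff, h]
    · convert ho ⟨l, by omega⟩
      simp [Fin.ext_iff, h]

@[simp] theorem wEven_inj {i j : Fin n} : wEven i = wEven j ↔ i = j :=
  mate_injective.eq_iff.trans v_inj
@[simp] theorem wOdd_inj {i j : Fin n} : wOdd i = wOdd j ↔ i = j :=
  mate_injective.eq_iff.trans u_inj
@[simp] theorem wEven_ne_wOdd {i j : Fin n} : wEven i ≠ wOdd j := mate_injective.ne (by simp)
@[simp] theorem wOdd_ne_wEven {i j : Fin n} : wOdd i ≠ wEven j := mate_injective.ne (by simp)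

theorem joinedOff_next (hn : 3 ≤ n) {a : RingVertex n} (ha : a ∉ B) (hb : next n a ∉ B) :
    JoinedOff (ringGraph n) B a (next n a) :=
  .of_adj ((ringGraph_adj hn).2 (Or.inl rfl)) (by simpa) (by simpa)

/-- A cycle of `D_n` without vertices in `B` lies in one component of `D_n - B`. -/
theorem joinedOff_of_clean_cycle (hn : 3 ≤ n) {N : ℕ} (g : Fin N → RingVertex n)
    (hg : ∀ i, next n (g i) = g (finRotate N i)) (hB : ∀ i, g i ∉ B) (i j : Fin N) :
    JoinedOff (ringGraph n) B (g i) (g j) := by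
  refine forall_of_finRotate (P := fun j => JoinedOff (ringGraph n) B (g i) (g j)) (.refl _) ?_ j
  intro j hj
  have := joinedOff_next hn (hB j) (hg j ▸ hB _)
  rw [hg] at this
  exact hj.trans this

/-- If one of the two cycles of the `u_i` and of the `v_i` avoids `B`, then everything off `B` is
joined to it. The graph is described in terms of four layers, of which the last one is this cycle:
layer `0` is the other one, and the layers `1` and `2` are made of the vertices `w_j`. From every
vertex in the layers `0` and `1` there are three paths to the clean layer that are disjoint up to
their ends. -/
theorem joinedOff_clean_layer {ι : Type*} {G : SimpleGraph V} {B : Finset V} (hB : B.card ≤ 2)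
    (F : Fin 4 → ι → V) (hF : Function.Injective2 F) (σ : Equiv.Perm ι)
    (hσ : ∀ i, σ i ≠ i) (hσσ : ∀ i, σ (σ i) ≠ i)
    (h₀ : ∀ i, G.Adj (F 0 i) (F 0 (σ i))) (h₀₁ : ∀ i, G.Adj (F 0 i) (F 1 i))
    (h₁₂ : ∀ i, G.Adj (F 1 i) (F 2 i)) (h₁₂' : ∀ i, G.Adj (F 1 i) (F 2 (σ i)))
    (h₂₃ : ∀ i, G.Adj (F 2 i) (F 3 i)) (clean : ∀ i, F 3 i ∉ B) (l : Fin 4) (i : ι)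
    (ha : F l i ∉ B) : ∃ j, JoinedOff G B (F l i) (F 3 j) := by
  have adj : ∀ {x y}, G.Adj x y → x ∉ B → y ∉ B → JoinedOff G B x y := fun h hx hy =>
    .of_adj h (by simpa) (by simpa)
  have J₂ : ∀ i, F 2 i ∉ B → JoinedOff G B (F 2 i) (F 3 i) := fun i h =>
    adj (h₂₃ i) h (clean i)
  have J₁ : ∀ i, F 1 i ∉ B → F 2 i ∉ B → JoinedOff G B (F 1 i) (F 3 i) := fun i h h' =>
    (adj (h₁₂ i) h h').trans (J₂ i h')
  have J₀ : ∀ i, F 0 i ∉ B → F 1 i ∉ B → F 2 i ∉ B → JoinedOff G B (F 0 i) (F 3 i) :=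
    fun i h h' h'' => (adj (h₀₁ i) h h').trans (J₁ i h' h'')
  have hσ' := hσ i
  have hσσ' := hσσ i
  have hσ'' := hσ (σ i)
  have hs : σ (σ.symm i) = i := by simp
  fin_cases l
  · have hs' := hσ (σ.symm i)
    have hs'' := hσσ (σ.symm i)
    rw [hs] at hs' hs''
    rcases exists_avoid hB (P := {F 1 i, F 2 i}) (Q := {F 0 (σ i), F 1 (σ i), F 2 (σ i)})
      (R := {F 0 (σ.symm i), F 1 (σ.symm i), F 2 (σ.symm i)})
      (by simp [hF.eq_iff, hσ']) (by simp [hF.eq_iff, hs'.symm])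
      (by simp [hF.eq_iff, hs''.symm]) with h | h | h
    · exact ⟨_, J₀ i ha (h _ (by simp)) (h _ (by simp))⟩
    · exact ⟨_, (adj (h₀ i) ha (h _ (by simp))).trans
        (J₀ _ (h _ (by simp)) (h _ (by simp)) (h _ (by simp)))⟩
    · have h' := h₀ (σ.symm i)
      rw [hs] at h'
      exact ⟨_, (adj h'.symm ha (h _ (by simp))).trans
        (J₀ _ (h _ (by simp)) (h _ (by simp)) (h _ (by simp)))⟩
  · rcases exists_avoid hB (P := {F 2 i}) (Q := {F 2 (σ i)})
      (R := {F 0 i, F 0 (σ i), F 1 (σ i), F 2 (σ (σ i))})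
      (by simp [hF.eq_iff, hσ'.symm]) (by simp [hF.eq_iff, hσσ'.symm])
      (by simp [hF.eq_iff, hσ''.symm]) with h | h | h
    · exact ⟨_, J₁ i ha (h _ (by simp))⟩
    · exact ⟨_, (adj (h₁₂' i) ha (h _ (by simp))).trans (J₂ _ (h _ (by simp)))⟩
    · exact ⟨_, (adj (h₀₁ i).symm ha (h _ (by simp))).trans <|
        (adj (h₀ i) (h _ (by simp)) (h _ (by simp))).trans <|
        (adj (h₀₁ _) (h _ (by simp)) (h _ (by simp))).trans <|
        (adj (h₁₂' _) (h _ (by simp)) (h _ (by simp))).trans (J₂ _ (h _ (by simp)))⟩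
  · exact ⟨_, J₂ i ha⟩
  · exact ⟨i, .refl _⟩

/-- `D_n` is 3-connected: one of its three cycles avoids `B`, and everything off `B` is joined
to it. -/
theorem ringGraph_joinedOff (hn : 3 ≤ n) (hB : B.card ≤ 2) {a b : RingVertex n} (ha : a ∉ B)
    (hb : b ∉ B) : JoinedOff (ringGraph n) B a b := by
  have adj_next : ∀ a : RingVertex n, (ringGraph n).Adj a (next n a) := fun a =>
    (ringGraph_adj hn).2 (Or.inl rfl)
  have adj_mate : ∀ a : RingVertex n, (ringGraph n).Adj a (mate a) := fun a =>
    (ringGraph_adj hn).2 (Or.inr (Or.inr rfl))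
  have adj_w : ∀ i : Fin n, (ringGraph n).Adj (wEven i) (wOdd i) := fun i => by
    rw [← next_wEven]
    exact adj_next _
  have rot : ∀ i : Fin n, finRotate n i ≠ i ∧ finRotate n (finRotate n i) ≠ i := fun i =>
    ⟨by simpa only [next_u, ne_eq, u_inj] using next_ne hn (u i),
      by simpa only [next_u, ne_eq, u_inj] using next_next_ne hn (u i)⟩
  have conclude : ∀ {N : ℕ} (g : Fin N → RingVertex n), (∀ i, next n (g i) = g (finRotate N i)) →
      (∀ i, g i ∉ B) → (∀ a, a ∉ B → ∃ i, JoinedOff (ringGraph n) B a (g i)) →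
      JoinedOff (ringGraph n) B a b := by
    intro N g hg hgB h
    obtain ⟨i, hi⟩ := h a ha
    obtain ⟨j, hj⟩ := h b hb
    exact hi.trans ((joinedOff_of_clean_cycle hn g hg hgB i j).trans hj.symm)
  rcases exists_avoid hB (P := Set.range u) (Q := Set.range v) (R := Set.range w)
    (Set.disjoint_left.2 (by simp [u, v])) (Set.disjoint_left.2 (by simp [u, w]))
    (Set.disjoint_left.2 (by simp [v, w])) with h | h | h
  · have h : ∀ i, u i ∉ B := fun i => h _ ⟨i, rfl⟩
    refine conclude u (fun _ => rfl) h fun a => ?_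
    have key := joinedOff_clean_layer (G := ringGraph n) hB ![v, wEven, wOdd, u]
      (by
        intro l l' i j hl
        fin_cases l <;> fin_cases l' <;>
          first
          | (exfalso; revert hl; simp [-mate_u, -mate_v]; done)
          | (exfalso; revert hl; simp; done)
          | (refine ⟨rfl, ?_⟩; simpa [-mate_u, -mate_v] using hl))
      (finRotate n).symm
      (fun i h => (rot i).1 (by conv_lhs => rw [← h, Equiv.apply_symm_apply]))
      (fun i h => (rot i).2 (by
        conv_lhs => rw [← h, Equiv.apply_symm_apply, Equiv.apply_symm_apply]))
      (fun i => by
        have := (adj_next (v ((finRotate n).symm i))).symm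
        rw [next_v, Equiv.apply_symm_apply] at this
        exact this)
      (fun i => adj_mate (v i))
      (fun i => adj_w i)
      (fun i => by
        have := (adj_next (wOdd ((finRotate n).symm i))).symm
        rw [next_wOdd, Equiv.apply_symm_apply] at this
        exact this)
      (fun i => (adj_mate (u i)).symm) h
    induction a using ringVertex_cases' with
    | hu i => exact key 3 i
    | hv i => exact key 0 i
    | he i => exact key 1 i
    | ho i => exact key 2 i
  · have h : ∀ i, v i ∉ B := fun i => h _ ⟨i, rfl⟩
    refine conclude v (fun _ => rfl) h fun a => ?_
    have key := joinedOff_clean_layer (G := ringGraph n) hB ![u, wOdd, wEven, v]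
      (by
        intro l l' i j hl
        fin_cases l <;> fin_cases l' <;>
          first
          | (exfalso; revert hl; simp [-mate_u, -mate_v]; done)
          | (exfalso; revert hl; simp; done)
          | (refine ⟨rfl, ?_⟩; simpa [-mate_u, -mate_v] using hl))
      (finRotate n) (fun i => (rot i).1) (fun i => (rot i).2)
      (fun i => adj_next (u i))
      (fun i => adj_mate (u i))
      (fun i => (adj_w i).symm)
      (fun i => by
        have := adj_next (wOdd i)
        rw [next_wOdd] at this
        exact this)
      (fun i => (adj_mate (v i)).symm) h
    induction a using ringVertex_cases' with
    | hu i => exact key 0 i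
    | hv i => exact key 3 i
    | he i => exact key 2 i
    | ho i => exact key 1 i
  · have h : ∀ j, w j ∉ B := fun j => h _ ⟨j, rfl⟩
    refine conclude w (fun _ => rfl) h fun a ha => ?_
    induction a using ringVertex_cases with
    | hu i => exact ⟨_, .of_adj (adj_mate (u i)) (by simpa) (by simpa using h _)⟩
    | hv i => exact ⟨_, .of_adj (adj_mate (v i)) (by simpa) (by simpa using h _)⟩
    | hw j => exact ⟨j, .refl _⟩

end Ring

section Replace

variable {n m : ℕ} {S : Finset (RingVertex n × Fin (2 * m + 1))}

/-- A way along the cycle that replaces `a`. -/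
theorem joinedOff_rail (hn : 3 ≤ n) (hm : 1 ≤ m) {a : RingVertex n} {i j : Fin (2 * m + 1)}
    (hij : i.val ≤ j.val) (h : ∀ l : Fin (2 * m + 1), i.val ≤ l.val → l.val ≤ j.val → (a, l) ∉ S) :
    JoinedOff (replacedRing n m) S (a, i) (a, j) := by
  obtain ⟨j, hj⟩ := j
  simp only at hij h
  induction j, hij using Nat.le_induction with
  | base => exact .refl _
  | succ j hij ih =>
    refine (ih (by omega) fun l h₁ h₂ => h l h₁ (by omega)).trans (.of_adj ?_ ?_ ?_)
    · rw [replacedRing_adj hn, chordedCycle_adj hm]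
      exact Or.inl ⟨rfl, Or.inl rfl⟩
    · simpa using h ⟨j, _⟩ hij (by simp)
    · simpa using h ⟨j + 1, _⟩ (by simp; omega) (by simp)

/-- Every vertex off `S` is joined to a vertex of `D_n` whose replacement avoids `S`: there are
three paths to the replacements of the three neighbours that are disjoint up to their first
vertex. -/
theorem exists_joinedOff_clean (hn : 3 ≤ n) (hm : 1 ≤ m) (hS : S.card ≤ 2) {a : RingVertex n}
    {i : Fin (2 * m + 1)} (ha : (a, i) ∉ S) :
    ∃ b, (∀ l, (b, l) ∉ S) ∧ ∃ l, JoinedOff (replacedRing n m) S (a, i) (b, l) := by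
  have h₁ := mate_ne a
  have h₂ := next_ne hn a
  have h₃ := prev_ne hn a
  have h₄ := mate_ne_next a
  have h₅ := mate_ne_prev a
  have h₆ := next_ne_prev hn a
  have hi := i.is_lt
  -- the other end of the edge between `i` and `2m - i`; this is `i` itself if `i = m`
  obtain ⟨r, hr⟩ : ∃ r : Fin (2 * m + 1), r.val = 2 * m - i.val := ⟨⟨2 * m - i.val, by omega⟩, rfl⟩
  have rung : r ≠ i → (replacedRing n m).Adj (a, i) (a, r) := by
    intro hne
    rw [replacedRing_adj hn, chordedCycle_adj hm]
    have := Fin.val_ne_of_ne hne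
    exact Or.inl ⟨rfl, by simp only; omega⟩
  have to_r : (a, r) ∉ S → JoinedOff (replacedRing n m) S (a, i) (a, r) := by
    intro h
    by_cases hne : r = i
    · rw [hne]
      exact .refl _
    · exact .of_adj (rung hne) (by simpa) (by simpa)
  have exit_prev : (∀ l, (prev n a, l) ∉ S) → (a, (0 : Fin (2 * m + 1))) ∉ S →
      JoinedOff (replacedRing n m) S (a, 0) (prev n a, Fin.last _) := fun h h' => by
    refine .of_adj ?_ (by simpa) (by simpa using h _)
    rw [replacedRing_adj hn]
    exact Or.inr (Or.inr (Or.inr ⟨(next_prev a).symm, rfl, rfl⟩))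
  have exit_next : (∀ l, (next n a, l) ∉ S) → (a, Fin.last (2 * m)) ∉ S →
      JoinedOff (replacedRing n m) S (a, Fin.last _) (next n a, 0) := fun h h' => by
    refine .of_adj ?_ (by simpa) (by simpa using h _)
    rw [replacedRing_adj hn]
    exact Or.inr (Or.inr (Or.inl ⟨rfl, rfl, rfl⟩))
  have exit_mate : (∀ l, (mate a, l) ∉ S) → (a, mid m) ∉ S →
      JoinedOff (replacedRing n m) S (a, mid m) (mate a, mid m) := fun h h' => by
    refine .of_adj ?_ (by simpa) (by simpa using h _)
    rw [replacedRing_adj hn]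
    exact Or.inr (Or.inl ⟨rfl, rfl, rfl⟩)
  have notMem : ∀ l, (l ≠ i → (a, l) ∉ S) → (a, l) ∉ S := by
    intro l h
    by_cases hl : l = i
    · rwa [hl]
    · exact h hl
  by_cases him : i.val ≤ m
  · rcases exists_avoid hS
      (P := {p | p.1 = prev n a ∨ (p.1 = a ∧ p.2.val < i.val)})
      (Q := {p | p.1 = mate a ∨ (p.1 = a ∧ i.val < p.2.val ∧ p.2.val ≤ m)})
      (R := {p | p.1 = next n a ∨ (p.1 = a ∧ r.val ≤ p.2.val ∧ p.2 ≠ i)})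
      (Set.disjoint_left.2 (by grind)) (Set.disjoint_left.2 (by grind))
      (Set.disjoint_left.2 (by grind)) with h | h | h
    · have clean : ∀ l, (prev n a, l) ∉ S := fun l => h _ (Or.inl rfl)
      have rail : ∀ l : Fin (2 * m + 1), l.val ≤ i.val → (a, l) ∉ S := fun l hl =>
        notMem l fun hne => h _ (Or.inr ⟨rfl, by
          have := Fin.val_ne_of_ne hne
          simp only
          omega⟩)
      exact ⟨_, clean, _, (joinedOff_rail hn hm (Fin.zero_le i) fun l _ hl => rail l hl).symm.trans
        (exit_prev clean (rail 0 (Fin.zero_le i)))⟩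
    · have clean : ∀ l, (mate a, l) ∉ S := fun l => h _ (Or.inl rfl)
      have rail : ∀ l : Fin (2 * m + 1), i.val ≤ l.val → l.val ≤ m → (a, l) ∉ S := fun l hl hl' =>
        notMem l fun hne => h _ (Or.inr ⟨rfl, by
          have := Fin.val_ne_of_ne hne
          simp only
          omega⟩)
      exact ⟨_, clean, _, (joinedOff_rail hn hm (j := mid m) him rail).trans
        (exit_mate clean (rail (mid m) him le_rfl))⟩
    · have clean : ∀ l, (next n a, l) ∉ S := fun l => h _ (Or.inl rfl)
      have rail : ∀ l : Fin (2 * m + 1), r.val ≤ l.val → (a, l) ∉ S := fun l hl =>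
        notMem l fun hne => h _ (Or.inr ⟨rfl, hl, hne⟩)
      exact ⟨_, clean, _, (to_r (rail r le_rfl)).trans <|
        (joinedOff_rail hn hm (Fin.le_last r) fun l hl _ => rail l hl).trans
        (exit_next clean (rail _ (Fin.le_last r)))⟩
  · rcases exists_avoid hS
      (P := {p | p.1 = prev n a ∨ (p.1 = a ∧ p.2.val ≤ r.val ∧ p.2 ≠ i)})
      (Q := {p | p.1 = mate a ∨ (p.1 = a ∧ m ≤ p.2.val ∧ p.2.val < i.val)})
      (R := {p | p.1 = next n a ∨ (p.1 = a ∧ i.val < p.2.val)})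
      (Set.disjoint_left.2 (by grind)) (Set.disjoint_left.2 (by grind))
      (Set.disjoint_left.2 (by grind)) with h | h | h
    · have clean : ∀ l, (prev n a, l) ∉ S := fun l => h _ (Or.inl rfl)
      have rail : ∀ l : Fin (2 * m + 1), l.val ≤ r.val → (a, l) ∉ S := fun l hl =>
        notMem l fun hne => h _ (Or.inr ⟨rfl, hl, hne⟩)
      exact ⟨_, clean, _, (to_r (rail r le_rfl)).trans <|
        (joinedOff_rail hn hm (Fin.zero_le r) fun l _ hl => rail l hl).symm.trans
        (exit_prev clean (rail 0 (Fin.zero_le r)))⟩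
    · have clean : ∀ l, (mate a, l) ∉ S := fun l => h _ (Or.inl rfl)
      have rail : ∀ l : Fin (2 * m + 1), m ≤ l.val → l.val ≤ i.val → (a, l) ∉ S := fun l hl hl' =>
        notMem l fun hne => h _ (Or.inr ⟨rfl, by
          have := Fin.val_ne_of_ne hne
          simp only
          omega⟩)
      exact ⟨_, clean, _, (joinedOff_rail hn hm (i := mid m) (by simp only [mid]; omega)
          rail).symm.trans
        (exit_mate clean (rail (mid m) le_rfl (by simp only [mid]; omega)))⟩
    · have clean : ∀ l, (next n a, l) ∉ S := fun l => h _ (Or.inl rfl)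
      have rail : ∀ l : Fin (2 * m + 1), i.val ≤ l.val → (a, l) ∉ S := fun l hl =>
        notMem l fun hne => h _ (Or.inr ⟨rfl, by
          have := Fin.val_ne_of_ne hne
          simp only
          omega⟩)
      exact ⟨_, clean, _, (joinedOff_rail hn hm (Fin.le_last i) fun l hl _ => rail l hl).trans
        (exit_next clean (rail _ (Fin.le_last i)))⟩

theorem joinedOff_of_clean (hn : 3 ≤ n) (hm : 1 ≤ m) {a : RingVertex n} (h : ∀ l, (a, l) ∉ S)
    (i j : Fin (2 * m + 1)) : JoinedOff (replacedRing n m) S (a, i) (a, j) := by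
  rcases le_total i.val j.val with hij | hij
  · exact joinedOff_rail hn hm hij fun l _ _ => h l
  · exact (joinedOff_rail hn hm hij fun l _ _ => h l).symm

theorem joinedOff_of_ringGraph_adj (hn : 3 ≤ n) (hm : 1 ≤ m) {a b : RingVertex n}
    (hab : (ringGraph n).Adj a b) (ha : ∀ l, (a, l) ∉ S) (hb : ∀ l, (b, l) ∉ S)
    (i j : Fin (2 * m + 1)) :
    JoinedOff (replacedRing n m) S (a, i) (b, j) := by
  obtain ⟨s, t, h⟩ : ∃ s t, (replacedRing n m).Adj (a, s) (b, t) := by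
    simp only [replacedRing_adj hn]
    rcases (ringGraph_adj hn).1 hab with h | h | h
    · exact ⟨_, _, Or.inr (Or.inr (Or.inl ⟨h, rfl, rfl⟩))⟩
    · exact ⟨_, _, Or.inr (Or.inr (Or.inr ⟨h, rfl, rfl⟩))⟩
    · exact ⟨_, _, Or.inr (Or.inl ⟨h, rfl, rfl⟩)⟩
  exact (joinedOff_of_clean hn hm ha i s).trans <|
    (JoinedOff.of_adj h (by simpa using ha s) (by simpa using hb t)).trans
    (joinedOff_of_clean hn hm hb t j)

/-- Connections in `D_n` off the vertices whose replacements meet `S` lift to connections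
off `S`. -/
theorem joinedOff_lift (hn : 3 ≤ n) (hm : 1 ≤ m) {B : Set (RingVertex n)} {a b : RingVertex n}
    (h : JoinedOff (ringGraph n) B a b) (hB : ∀ {c}, c ∉ B → ∀ l, (c, l) ∉ S)
    (ha : ∀ l, (a, l) ∉ S) (i j : Fin (2 * m + 1)) :
    JoinedOff (replacedRing n m) S (a, i) (b, j) := by
  induction h generalizing j with
  | refl => exact joinedOff_of_clean hn hm ha i j
  | tail _ h ih =>
    exact (ih 0).trans (joinedOff_of_ringGraph_adj hn hm h.1 (hB h.2.1) (hB h.2.2) 0 j)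

theorem isThreeConnected_replacedRing (hn : 3 ≤ n) (hm : 1 ≤ m) :
    IsThreeConnected (replacedRing n m) := by
  classical
  have card : 12 ≤ Fintype.card (RingVertex n × Fin (2 * m + 1)) := by
    simp only [Fintype.card_prod, Fintype.card_sum, Fintype.card_fin]
    nlinarith
  refine ⟨by omega, fun S hS => ?_⟩
  rw [connected_iff]
  constructor
  · rintro ⟨⟨a, i⟩, ha⟩ ⟨⟨b, j⟩, hb⟩
    refine JoinedOff.reachable ?_ ha hb
    obtain ⟨a', ha', i', hi'⟩ := exists_joinedOff_clean hn hm (by omega) ha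
    obtain ⟨b', hb', j', hj'⟩ := exists_joinedOff_clean hn hm (by omega) hb
    refine hi'.trans (JoinedOff.trans ?_ hj'.symm)
    -- the vertices of `D_n` whose replacements meet `S`
    let B := S.image Prod.fst
    have mem_B : ∀ {c}, c ∉ B ↔ ∀ l, (c, l) ∉ S := by
      intro c
      simp [B]
    have hB : B.card ≤ 2 := Finset.card_image_le.trans (by omega)
    have key := ringGraph_joinedOff hn hB (mem_B.2 ha') (mem_B.2 hb')
    exact joinedOff_lift hn hm key (fun hc => mem_B.1 (by simpa using hc)) ha' i' j'
  · by_contra hne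
    have : (Finset.univ : Finset (RingVertex n × Fin (2 * m + 1))) ⊆ S := by
      intro p _
      by_contra hp
      exact hne ⟨⟨p, hp⟩⟩
    have := Finset.card_le_card this
    rw [Finset.card_univ] at this
    omega

end Replace

/-! ### Cycle lengths -/

section Cuts

variable {G : SimpleGraph V}

theorem sum_edges_eq_add (f : V → ZMod 2) {x y : V} (p : G.Walk x y) :
    (p.edges.map (Sym2.lift ⟨fun a b => f a + f b, fun _ _ => add_comm _ _⟩)).sum = f x + f y := by
  induction p with
  | nil => simp [CharTwo.add_self_eq_zero]
  | @cons x z y h p ih =>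
    rw [Walk.edges_cons, List.map_cons, List.sum_cons, ih, Sym2.lift_mk]
    linear_combination CharTwo.add_self_eq_zero (f z)

/-- A closed trail uses an even number of edges of every cut, so it does not use just one. -/
theorem exists_second_edge_of_cut {x : V} {c : G.Walk x x} (hc : c.IsTrail) {X : Set V} {p q : V}
    (hp : p ∈ X) (hq : q ∉ X) (he : s(p, q) ∈ c.edges) :
    ∃ p' q', p' ∈ X ∧ q' ∉ X ∧ s(p', q') ∈ c.edges ∧ s(p', q') ≠ s(p, q) := by
  classical
  by_contra! h
  let f : V → ZMod 2 := fun z => if z ∈ X then 1 else 0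
  have hsum := sum_edges_eq_add f c
  rw [CharTwo.add_self_eq_zero, ← List.sum_toFinset _ hc.edges_nodup,
    Finset.sum_eq_single s(p, q)] at hsum
  · simp [f, hp, hq] at hsum
  · intro e
    induction e with | _ a b
    intro hab hne
    rw [List.mem_toFinset] at hab
    simp only [Sym2.lift_mk, f]
    by_cases ha : a ∈ X <;> by_cases hb : b ∈ X
    · simp [ha, hb, CharTwo.add_self_eq_zero]
    · exact absurd (h a b ha hb hab) hne
    · rw [Sym2.eq_swap] at hab hne
      exact absurd (h b a hb ha hab) hne
    · simp [ha, hb]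
  · intro h'
    exact absurd (List.mem_toFinset.2 he) h'

theorem card_support_toFinset [DecidableEq V] {x : V} {c : G.Walk x x} (hc : c.IsCycle) :
    c.support.toFinset.card = c.length := by
  have h : c.support.toFinset = c.support.tail.toFinset := by
    ext y
    rw [List.mem_toFinset, List.mem_toFinset, Walk.mem_support_iff]
    refine ⟨?_, Or.inr⟩
    rintro (rfl | h)
    · exact Walk.end_mem_tail_support hc.not_nil
    · exact h
  rw [h, List.toFinset_card_of_nodup hc.support_nodup, List.length_tail, Walk.length_support,
    Nat.add_sub_cancel]

theorem length_le_circumference [Fintype V] {x : V} {c : G.Walk x x} (hc : c.IsCycle) :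
    c.length ≤ circumference G := by
  classical
  refine le_csSup ⟨Fintype.card V, ?_⟩ ⟨x, c, hc, rfl⟩
  rintro _ ⟨y, c', hc', rfl⟩
  rw [← card_support_toFinset hc']
  exact Finset.card_le_univ _

/-- In a 3-connected graph an edge `pq` lies on a cycle if `q` has a further neighbour. -/
theorem exists_cycle_of_isThreeConnected [Fintype V] (hG : IsThreeConnected G) {p q r : V}
    (hpq : G.Adj p q) (hqr : G.Adj q r) (hpr : p ≠ r) :
    ∃ (x : V) (c : G.Walk x x), c.IsCycle ∧ s(p, q) ∈ c.edges := by
  classical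
  rw [← adj_and_reachable_delete_edges_iff_exists_cycle]
  refine ⟨hpq, ?_⟩
  have hreach := (hG.2 {q} (by simp)).preconnected ⟨p, by simpa using hpq.ne⟩
    ⟨r, by simpa using hqr.ne'⟩
  let φ : G.induce {z | z ∉ ({q} : Finset V)} →g G.deleteEdges {s(p, q)} :=
    { toFun := Subtype.val
      map_rel' := by
        rintro ⟨a, ha⟩ ⟨b, hb⟩ hab
        simp only [Finset.mem_singleton, Set.mem_ofPred_eq] at ha hb
        simp only [comap_adj, Function.Embedding.subtype_apply] at hab
        rw [deleteEdges_adj]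
        exact ⟨hab, by simp [ha, hb]⟩ }
  refine (hreach.map φ).trans (Adj.reachable (deleteEdges_adj.2 ⟨hqr.symm, ?_⟩))
  show s(r, q) ∉ ({s(p, q)} : Set (Sym2 V))
  simp [hpr.symm, hqr.ne']

end Cuts

section Lengths

variable {n m : ℕ}

variable {x : RingVertex n × Fin (2 * m + 1)} {c : (replacedRing n m).Walk x x}

/-- The vertices of a walk among those that replace the vertex `a` of `D_n`. -/
def visits {y z : RingVertex n × Fin (2 * m + 1)} (c : (replacedRing n m).Walk y z)
    (a : RingVertex n) : Finset (RingVertex n × Fin (2 * m + 1)) :=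
  {p ∈ c.support.toFinset | p.1 = a}

theorem mem_visits {y z : RingVertex n × Fin (2 * m + 1)} {c : (replacedRing n m).Walk y z}
    {a : RingVertex n} {p : RingVertex n × Fin (2 * m + 1)} :
    p ∈ visits c a ↔ p ∈ c.support ∧ p.1 = a := by
  simp [visits]

theorem sum_card_visits_le (hc : c.IsCycle) (A : Finset (RingVertex n)) :
    ∑ a ∈ A, (visits c a).card ≤ c.length := by
  rw [← card_support_toFinset hc, Finset.card_eq_sum_card_fiberwise (f := Prod.fst)
    (t := Finset.univ) (fun _ _ => Finset.mem_coe.2 (Finset.mem_univ _))]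
  exact Finset.sum_le_sum_of_subset (Finset.subset_univ _)

theorem edge_leaving (hn : 3 ≤ n) {p q : RingVertex n × Fin (2 * m + 1)}
    (h : (replacedRing n m).Adj p q) (hpq : q.1 ≠ p.1) :
    (p = (p.1, mid m) ∧ q = (mate p.1, mid m)) ∨
    (p = (p.1, Fin.last _) ∧ q = (next n p.1, 0)) ∨
    (p = (p.1, 0) ∧ q = (prev n p.1, Fin.last _)) := by
  obtain ⟨a, i⟩ := p
  obtain ⟨b, j⟩ := q
  rw [replacedRing_adj hn] at h
  simp only [eq_next_iff (a := a)] at h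
  simp only [Prod.mk.injEq, true_and] at h hpq ⊢
  tauto

/-- A cycle that uses an edge leaving the replacement of a vertex of `D_n` uses a second one, at a
different exit. -/
theorem exists_second_exit (hn : 3 ≤ n) (hm : 1 ≤ m) (hc : c.IsCycle)
    {p q : RingVertex n × Fin (2 * m + 1)} (he : s(p, q) ∈ c.edges) (hpq : q.1 ≠ p.1) :
    ∃ p' q', s(p', q') ∈ c.edges ∧ p'.1 = p.1 ∧ q'.1 ≠ p.1 ∧ p'.2 ≠ p.2 := by
  obtain ⟨p', q', hp', hq', he', hne⟩ := exists_second_edge_of_cut hc.isTrail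
    (X := {z | z.1 = p.1}) rfl hpq he
  have hp' : p'.1 = p.1 := hp'
  have hq' : q'.1 ≠ p.1 := hq'
  refine ⟨p', q', he', hp', hq', fun h2 => hne ?_⟩
  have hpp : p' = p := Prod.ext hp' h2
  subst hpp
  have h0 : mid m ≠ 0 := by simp only [ne_eq, Fin.ext_iff, mid, Fin.val_zero]; omega
  have h1 : mid m ≠ Fin.last (2 * m) := by simp only [ne_eq, Fin.ext_iff, mid, Fin.val_last]; omega
  have h01 : (0 : Fin (2 * m + 1)) ≠ Fin.last (2 * m) := by
    simp only [ne_eq, Fin.ext_iff, Fin.val_last, Fin.val_zero]; omega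
  have e₁ := edge_leaving hn (c.adj_of_mem_edges he) hpq
  have e₂ := edge_leaving hn (c.adj_of_mem_edges he') hq'
  suffices q' = q by rw [this]
  rcases e₁ with ⟨h, rfl⟩ | ⟨h, rfl⟩ | ⟨h, rfl⟩ <;>
    rcases e₂ with ⟨h', rfl⟩ | ⟨h', rfl⟩ | ⟨h', rfl⟩ <;>
    first
    | rfl
    | (exfalso
       have := congrArg Prod.snd (h.symm.trans h')
       simp only at this
       first
       | exact h0 this
       | exact h0 this.symm
       | exact h1 this
       | exact h1 this.symm
       | exact h01 this
       | exact h01 this.symm)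

theorem two_le_card_visits (hn : 3 ≤ n) (hm : 1 ≤ m) (hc : c.IsCycle)
    {p q : RingVertex n × Fin (2 * m + 1)} (he : s(p, q) ∈ c.edges) (hpq : q.1 ≠ p.1) :
    2 ≤ (visits c p.1).card := by
  obtain ⟨p', q', he', hp', -, hne⟩ := exists_second_exit hn hm hc he hpq
  refine Finset.one_lt_card.2 ⟨p', ?_, p, ?_, fun h => hne (by rw [h])⟩
  · exact mem_visits.2 ⟨c.fst_mem_support_of_mem_edges he', hp'⟩
  · exact mem_visits.2 ⟨c.fst_mem_support_of_mem_edges he, rfl⟩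

/-- A cycle that uses the edge of `M` at `a` reaches `x_m`, so it meets each of the pairs
`x_t`, `x_{2m-t}`: the edge of `M` lies in the cut around the part of the gadget between such a pair
and `x_m`, and the other edges of this cut start at `x_t` and at `x_{2m-t}`. -/
theorem succ_le_card_visits (hn : 3 ≤ n) (hm : 1 ≤ m) (hc : c.IsCycle) {a : RingVertex n}
    (he : s((a, mid m), (mate a, mid m)) ∈ c.edges) : m + 1 ≤ (visits c a).card := by
  have level : ∀ t ≤ m, ∃ p ∈ visits c a, p.2.val = t ∨ p.2.val = 2 * m - t := by
    intro t ht
    rcases ht.eq_or_lt with rfl | ht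
    · exact ⟨_, mem_visits.2 ⟨c.fst_mem_support_of_mem_edges he, rfl⟩, Or.inl rfl⟩
    obtain ⟨⟨b, i⟩, ⟨d, j⟩, ⟨rfl, hi, hi'⟩, hq, he', hne⟩ := exists_second_edge_of_cut hc.isTrail
      (X := {z | z.1 = a ∧ t < z.2.val ∧ z.2.val < 2 * m - t})
      ⟨rfl, by simp only [mid]; omega, by simp only [mid]; omega⟩ (fun h => mate_ne a h.1) he
    have hadj := c.adj_of_mem_edges he'
    simp only [Set.mem_ofPred_eq] at hi hi' hq
    by_cases hd : d = b
    · subst hd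
      refine ⟨(d, j), mem_visits.2 ⟨c.snd_mem_support_of_mem_edges he', rfl⟩, ?_⟩
      rw [replacedRing_adj hn, chordedCycle_adj hm] at hadj
      have h₁ := mate_ne d
      have h₂ := next_ne hn d
      rcases hadj with ⟨-, h⟩ | ⟨h, -⟩ | ⟨h, -⟩ | ⟨h, -⟩
      · simp only [true_and, not_and] at h hq ⊢
        omega
      · exact absurd h.symm h₁
      · exact absurd h.symm h₂
      · exact absurd h.symm h₂
    · exfalso
      rcases edge_leaving hn hadj hd with ⟨h, h'⟩ | ⟨h, -⟩ | ⟨h, -⟩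
      · exact hne (by rw [h, h'])
      · have := congrArg (fun z => z.2.val) h
        simp only [Fin.val_last] at this
        omega
      · have := congrArg (fun z => z.2.val) h
        simp only [Fin.val_zero] at this
        omega
  have hsub : Finset.range (m + 1) ⊆
      (visits c a).image fun p => min p.2.val (2 * m - p.2.val) := by
    intro t ht
    rw [Finset.mem_range] at ht
    obtain ⟨p, hp, h⟩ := level t (by omega)
    exact Finset.mem_image.2 ⟨p, hp, by omega⟩
  calc m + 1 = (Finset.range (m + 1)).card := (Finset.card_range _).symm
    _ ≤ _ := Finset.card_le_card hsub
    _ ≤ _ := Finset.card_image_le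

/-- A cycle without edges between the replacements of different vertices of `D_n` is short. -/
theorem exists_edge_leaving_of_lt_length (hc : c.IsCycle) (hlen : 2 * m + 1 < c.length) :
    ∃ p q, s(p, q) ∈ c.edges ∧ q.1 ≠ p.1 := by
  classical
  by_cases h : ∃ q ∈ c.support, q.1 ≠ x.1
  · obtain ⟨q, hq, hne⟩ := h
    obtain ⟨d, hd, h₁, h₂⟩ := (c.takeUntil q hq).exists_boundary_dart {z | z.1 = x.1} rfl hne
    refine ⟨d.fst, d.snd, c.edges_takeUntil_subset_edges hq ?_, fun h => h₂ (h.trans h₁)⟩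
    exact List.mem_map_of_mem hd
  · push Not at h
    exfalso
    have hsub : c.support.toFinset ⊆
        (Finset.univ : Finset (Fin (2 * m + 1))).image fun l => (x.1, l) := by
      intro p hp
      rw [List.mem_toFinset] at hp
      exact Finset.mem_image.2 ⟨p.2, Finset.mem_univ _, Prod.ext (h p hp).symm rfl⟩
    have := (Finset.card_le_card hsub).trans Finset.card_image_le
    rw [card_support_toFinset hc, Finset.card_univ, Fintype.card_fin] at this
    omega

/-- A cycle that uses an edge of `M` at a vertex of the cycle `R` of the `u_i` or of the `v_i`: it
uses a second such edge, which gives `m + 1` vertices at each end of the two edges, and it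
continues on the cycle of the `w_j` to a vertex whose mate does not lie on `R`. -/
theorem le_length_of_mate (hn : 3 ≤ n) (hm : 1 ≤ m) (hc : c.IsCycle) (R : Set (RingVertex n))
    (hnext : ∀ a, next n a ∈ R ↔ a ∈ R) (hmate : ∀ a ∈ R, mate a ∉ R)
    (hmn : ∀ a ∈ R, mate (next n (mate a)) ∉ R) (hmp : ∀ a ∈ R, mate (prev n (mate a)) ∉ R)
    {a : RingVertex n} (ha : a ∈ R) (he : s((a, mid m), (mate a, mid m)) ∈ c.edges) :
    4 * (m + 1) + 2 ≤ c.length := by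
  classical
  have hprev : ∀ a, prev n a ∈ R ↔ a ∈ R := fun a => by rw [← hnext, next_prev]
  obtain ⟨a', ha', hne, he'⟩ : ∃ a' ∈ R, a' ≠ a ∧ s((a', mid m), (mate a', mid m)) ∈ c.edges := by
    obtain ⟨p, q, hp, hq, he', hne⟩ := exists_second_edge_of_cut hc.isTrail
      (X := {z | z.1 ∈ R}) ha (hmate a ha) he
    have hp : p.1 ∈ R := hp
    have hq : q.1 ∉ R := hq
    rcases edge_leaving hn (c.adj_of_mem_edges he') (fun h => hq (h ▸ hp)) with h | h | h
    · refine ⟨p.1, hp, ?_, ?_⟩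
      · intro h'
        rw [h'] at h
        exact hne (by rw [h.1, h.2])
      · rw [← h.1, ← h.2]
        exact he'
    · rw [h.2] at hq
      exact absurd ((hnext _).2 hp) hq
    · rw [h.2] at hq
      exact absurd ((hprev _).2 hp) hq
  have swap : ∀ {b : RingVertex n}, s((b, mid m), (mate b, mid m)) ∈ c.edges →
      s((mate b, mid m), (mate (mate b), mid m)) ∈ c.edges := fun h => by
    rwa [mate_mate, Sym2.eq_swap]
  -- the vertex of `D_n` to which the cycle continues from `mate a`
  obtain ⟨d, hd, hdR, hmd, hdne⟩ :
      ∃ d, 2 ≤ (visits c d).card ∧ d ∉ R ∧ mate d ∉ R ∧ d ≠ mate a := by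
    obtain ⟨p, q, hpq, hp, hq, hport⟩ := exists_second_exit hn hm hc (swap he) (mate_ne _)
    simp only at hp hq hport
    refine ⟨q.1, two_le_card_visits hn hm hc (p := q) (q := p) (by rwa [Sym2.eq_swap])
      (by rw [hp]; exact hq.symm), ?_, ?_, hq⟩
    all_goals
      rcases edge_leaving hn (c.adj_of_mem_edges hpq) (by rwa [hp]) with h | h | h
      · exact absurd (congrArg Prod.snd h.1) hport
      · rw [h.2, hp]
        first
        | exact hmn a ha
        | exact fun h => hmate a ha ((hnext _).1 h)
      · rw [h.2, hp]
        first
        | exact hmp a ha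
        | exact fun h => hmate a ha ((hprev _).1 h)
  have h₁ := succ_le_card_visits hn hm hc he
  have h₂ := succ_le_card_visits hn hm hc he'
  have h₃ := succ_le_card_visits hn hm hc (swap he)
  have h₄ := succ_le_card_visits hn hm hc (swap he')
  have hsum := sum_card_visits_le hc {a, a', mate a, mate a', d}
  have ne_mate : ∀ {b b'}, b ∈ R → b' ∈ R → b ≠ mate b' := fun h h' h'' => hmate _ h' (h'' ▸ h)
  have ne_d : ∀ {b}, b ∈ R → b ≠ d := fun h h' => hdR (h' ▸ h)
  have hd' : mate a' ≠ d := fun h => hmd (by rwa [← h, mate_mate])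
  rw [Finset.sum_insert, Finset.sum_insert, Finset.sum_insert, Finset.sum_insert,
    Finset.sum_singleton] at hsum
  · omega
  · simpa using hd'
  · simp [mate_injective.eq_iff, hne.symm, hdne.symm]
  · simp [ne_mate ha' ha, ne_mate ha' ha', ne_d ha']
  · simp [hne.symm, ne_mate ha ha, ne_mate ha ha', ne_d ha]

/-- A cycle without edges of `M` that runs between the replacements of different vertices follows
one of the three cycles of `D_n`. -/
theorem le_length_of_next (hn : 3 ≤ n) (hm : 1 ≤ m) (hc : c.IsCycle)
    (hM : ∀ a, s((a, mid m), (mate a, mid m)) ∉ c.edges) {a : RingVertex n}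
    (he : s((a, Fin.last (2 * m)), (next n a, 0)) ∈ c.edges) : 2 * n ≤ c.length := by
  classical
  let P : RingVertex n → Prop := fun a => s((a, Fin.last (2 * m)), (next n a, 0)) ∈ c.edges
  have step : ∀ b, P b → P (next n b) := by
    intro b hb
    have hb : s((b, Fin.last (2 * m)), (next n b, 0)) ∈ c.edges := hb
    rw [Sym2.eq_swap] at hb
    obtain ⟨p, q, hpq, hp, hq, hport⟩ := exists_second_exit hn hm hc hb (next_ne hn b).symm
    simp only at hp hq hport
    rcases edge_leaving hn (c.adj_of_mem_edges hpq) (by rwa [hp]) with h | h | h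
    · rw [h.1, h.2] at hpq
      exact absurd hpq (hM _)
    · rw [h.1, h.2, hp] at hpq
      exact hpq
    · exact absurd (congrArg Prod.snd h.1) hport
  obtain ⟨g, hg, hgP⟩ : ∃ g : Fin n → RingVertex n, Function.Injective g ∧ ∀ i, P (g i) := by
    have ha : P a := he
    induction a using ringVertex_cases with
    | hu i => exact ⟨u, fun _ _ => u_inj.1, forall_of_finRotate ha fun j => step (u j)⟩
    | hv i => exact ⟨v, fun _ _ => v_inj.1, forall_of_finRotate ha fun j => step (v j)⟩
    | hw i =>
      refine ⟨fun j => w (Fin.castLE (by omega) j), fun j j' h => ?_, fun j => ?_⟩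
      · exact Fin.castLE_injective _ (w_inj.1 h)
      · exact forall_of_finRotate (P := fun j => P (w j)) ha (fun j => step (w j)) _
  have hsum := sum_card_visits_le hc (Finset.univ.image g)
  rw [Finset.sum_image hg.injOn] at hsum
  have : ∑ _i : Fin n, 2 ≤ ∑ i, (visits c (g i)).card := Finset.sum_le_sum fun i _ =>
    two_le_card_visits hn hm hc (hgP i) (next_ne hn (g i))
  simp only [Finset.sum_const, Finset.card_univ, Fintype.card_fin, smul_eq_mul] at this
  omega

theorem le_length_of_edge_leaving (hm : 1 ≤ m) (hn : 4 * (m + 1) + 2 ≤ n) (hc : c.IsCycle)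
    {p q : RingVertex n × Fin (2 * m + 1)} (he : s(p, q) ∈ c.edges) (hpq : q.1 ≠ p.1) :
    4 * (m + 1) + 2 ≤ c.length := by
  have hn3 : 3 ≤ n := by omega
  by_cases hM : ∃ a, s((a, mid m), (mate a, mid m)) ∈ c.edges
  · obtain ⟨a, ha⟩ := hM
    have ofU : ∀ i, s((u i, mid m), (wOdd i, mid m)) ∈ c.edges → 4 * (m + 1) + 2 ≤ c.length := by
      intro i h
      refine le_length_of_mate hn3 hm hc (Set.range u) ?_ ?_ ?_ ?_ ⟨i, rfl⟩ h
      · intro a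
        induction a using ringVertex_cases <;> simp
      · rintro _ ⟨j, rfl⟩
        simp
      · rintro _ ⟨j, rfl⟩
        rw [next_wOdd, mate_mate]
        simp
      · rintro _ ⟨j, rfl⟩
        change mate (prev n (wOdd j)) ∉ _
        rw [← next_wEven, prev_next, mate_mate]
        simp
    have ofV : ∀ i, s((v i, mid m), (wEven i, mid m)) ∈ c.edges → 4 * (m + 1) + 2 ≤ c.length := by
      intro i h
      refine le_length_of_mate hn3 hm hc (Set.range v) ?_ ?_ ?_ ?_ ⟨i, rfl⟩ h
      · intro a
        induction a using ringVertex_cases <;> simp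
      · rintro _ ⟨j, rfl⟩
        simp
      · rintro _ ⟨j, rfl⟩
        rw [next_wEven, mate_mate]
        simp
      · rintro _ ⟨j, rfl⟩
        obtain ⟨j, rfl⟩ := (finRotate n).surjective j
        change mate (prev n (wEven (finRotate n j))) ∉ _
        rw [← next_wOdd, prev_next, mate_mate]
        simp
    induction a using ringVertex_cases' with
    | hu i => exact ofU i ha
    | hv i => exact ofV i ha
    | he i => exact ofV i (by rwa [mate_mate, Sym2.eq_swap] at ha)
    | ho i => exact ofU i (by rwa [mate_mate, Sym2.eq_swap] at ha)
  · push Not at hM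
    suffices 2 * n ≤ c.length by omega
    rcases edge_leaving hn3 (c.adj_of_mem_edges he) hpq with h | h | h
    · rw [h.1, h.2] at he
      exact absurd he (hM _)
    · rw [h.1, h.2] at he
      exact le_length_of_next hn3 hm hc hM he
    · rw [h.1, h.2, Sym2.eq_swap] at he
      exact le_length_of_next hn3 hm hc hM (a := prev n p.1) (by rwa [next_prev])

theorem length_lt_or_le_length (hm : 1 ≤ m) (hn : 4 * (m + 1) + 2 ≤ n) (hc : c.IsCycle) :
    c.length < 2 * (m + 1) ∨ 4 * (m + 1) + 2 ≤ c.length := by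
  refine or_iff_not_imp_left.2 fun h => ?_
  obtain ⟨p, q, he, hpq⟩ := exists_edge_leaving_of_lt_length hc (by omega)
  exact le_length_of_edge_leaving hm hn hc he hpq

theorem le_circumference (hm : 1 ≤ m) (hn : 4 * (m + 1) + 2 ≤ n) :
    2 * (m + 1) ≤ circumference (replacedRing n m) := by
  have hn3 : 3 ≤ n := by omega
  let a : RingVertex n := v ⟨0, by omega⟩
  obtain ⟨x, c, hc, he⟩ := exists_cycle_of_isThreeConnected
    (isThreeConnected_replacedRing (n := n) hn3 hm) (p := (a, mid m)) (q := (mate a, mid m))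
    (r := (mate a, ⟨m - 1, by omega⟩))
    ((replacedRing_adj hn3).2 (Or.inr (Or.inl ⟨rfl, rfl, rfl⟩)))
    ((replacedRing_adj hn3).2 (Or.inl ⟨rfl, by
      rw [chordedCycle_adj hm]
      simp only [mid]
      omega⟩))
    (fun h => mate_ne a (congrArg Prod.fst h).symm)
  have := le_length_of_edge_leaving hm hn hc he (mate_ne a)
  have := length_le_circumference hc
  omega

end Lengths

theorem card_replacedRing (n m : ℕ) :
    Fintype.card (RingVertex n × Fin (2 * m + 1)) = 4 * n * (2 * m + 1) := by
  simp only [Fintype.card_prod, Fintype.card_sum, Fintype.card_fin]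
  ring

end CycleGap

theorem mainTheorem3 (k : ℕ) (hk : 2 ≤ k) :
    (∃ (V : Type) (_ : Fintype V) (G : SimpleGraph V),
      CycleGap.IsThreeConnected G ∧ CycleGap.IsCubic G ∧ CycleGap.IsPlanar G ∧
      2 * k ≤ CycleGap.circumference G ∧
      CycleGap.cycleSpectrum G ∩ Set.Icc (2 * k) (4 * k + 1) = ∅) ∧
    (∀ n : ℕ, 4 * k + 2 ≤ n →
      CycleGap.IsThreeConnected (CycleGap.gapGraph n k) ∧
      CycleGap.IsCubic (CycleGap.gapGraph n k) ∧
      CycleGap.IsPlanar (CycleGap.gapGraph n k) ∧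
      2 * k ≤ CycleGap.circumference (CycleGap.gapGraph n k) ∧
      CycleGap.cycleSpectrum (CycleGap.gapGraph n k) ∩ Set.Icc (2 * k) (4 * k + 1) = ∅) ∧
    (∀ n n' : ℕ, 4 * k + 2 ≤ n → 4 * k + 2 ≤ n' → n ≠ n' →
      IsEmpty (CycleGap.gapGraph n k ≃g CycleGap.gapGraph n' k)) := by
  obtain ⟨m, rfl⟩ : ∃ m, k = m + 1 := ⟨k - 1, by omega⟩
  have hm : 1 ≤ m := by omega
  have main : ∀ n : ℕ, 4 * (m + 1) + 2 ≤ n →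
      CycleGap.IsThreeConnected (CycleGap.gapGraph n (m + 1)) ∧
      CycleGap.IsCubic (CycleGap.gapGraph n (m + 1)) ∧
      CycleGap.IsPlanar (CycleGap.gapGraph n (m + 1)) ∧
      2 * (m + 1) ≤ CycleGap.circumference (CycleGap.gapGraph n (m + 1)) ∧
      CycleGap.cycleSpectrum (CycleGap.gapGraph n (m + 1)) ∩
        Set.Icc (2 * (m + 1)) (4 * (m + 1) + 1) = ∅ := by
    intro n hn
    have hn3 : 3 ≤ n := by omega
    refine ⟨CycleGap.isThreeConnected_replacedRing hn3 hm, CycleGap.isCubic_replacedRing hn3 hm,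
      CycleGap.isPlanar_replacedRing hn3 hm, CycleGap.le_circumference hm hn, ?_⟩
    rw [Set.eq_empty_iff_forall_notMem]
    rintro _ ⟨⟨x, c, hc, rfl⟩, h₁, h₂⟩
    rcases CycleGap.length_lt_or_le_length (m := m) hm hn hc with h | h
    · exact absurd h₁ (not_le.2 h)
    · exact absurd h₂ (not_le.2 h)
  refine ⟨⟨_, _, _, main _ le_rfl⟩, main, fun n n' _ _ hne => ⟨fun φ => hne ?_⟩⟩
  have hcard := Fintype.card_congr φ.toEquiv
  rw [CycleGap.card_replacedRing, CycleGap.card_replacedRing] at hcard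
  have hpos : 0 < 2 * (m + 1 - 1) + 1 := by omega
  have := Nat.eq_of_mul_eq_mul_right hpos hcard
  omega
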